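/- **Setting.** Let $n\ge 2$ and $\mathcal A=\{1,\dots,n\}$. A dueling bandits problem with indifferences is $\mathbf P=(P_\succ,P_\cong,P_\prec)$ with $P_\succ,P_\cong,P_\prec\in[0,1]^{n\times n}$, $P_\succ^{(i,j)}+P_\cong^{(i,j)}+P_\prec^{(i,j)}=1$ and $P_\succ^{(j,i)}=P_\prec^{(i,j)}$ for all $i,j$. In each round a (possibly randomized) algorithm $A$ either chooses, depending on the past and its internal randomness, a pair $(i,j)\in\mathcal A\times\mathcal A$ and observes $i\succ j$, $i\cong j$ or $i\prec j$ with probabilities $P_\succ^{(i,j)},P_\cong^{(i,j)},P_\prec^{(i,j)}$ (independently of the past), or it stops and outputs an arm $\hat\imath$. Let $\tau\in\{0,1,\dots\}\cup\{\infty\}$ be the number of pairs chosen before stopping. For $j\in\mathcal A$ let $$L(j)=\{i\ne j: P_\succ^{(i,j)}>\max\{P_\prec^{(i,j)},P_\cong^{(i,j)}\}\},\qquad I(j)=\{i\ne j: P_\cong^{(i,j)}>\max\{P_\prec^{(i,j)},P_\succ^{(i,j)}\}\},$$ $$\mathrm{CP}(i)=\#\{j\ne i:P_\succ^{(i,j)}>\max\{P_\prec^{(i,j)},P_\cong^{(i,j)}\}\}+\tfrac12\,\#\{j\neq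 i:P_\cong^{(i,j)}>\max\{P_\succ^{(i,j)},P_\prec^{(i,j)}\}\},$$ $\mathcal C(\mathbf P)=\{i:\mathrm{CP}(i)=\max_k\mathrm{CP}(k)\}$ and $d_j=\max_i\mathrm{CP}(i)-\mathrm{CP}(j)$. For $\delta\in(0,1)$ and a class of problems, $A$ *identifies the Copeland winner with confidence $1-\delta$* on this class if for each $\mathbf P$ in the class the probability that $A$ stops and outputs some $\hat\imath\notin\mathcal C(\mathbf P)$ is at most $\delta$. $\mathrm{KL}(p,q)\in[0,\infty]$ is the Kullback–Leibler divergence of categorical distributions, $\mathrm{kl}(p,q)=\mathrm{KL}((p,1-p),(q,1-q))$, and $1/\infty=0$. **Theorem.** Let $\delta\in(0,1)$ and consider the bound $$\mathbb E_{\mathbf P}[\tau]\ \ge\ \ln\frac1{2.4\,\delta}\ \sum_{j\in\mathcal A\setminus\{i^*\}}C_j\ \min_{k\in L(j)\cup I(j)}\frac1{D_{j,k}(\mathbf P)}\qquad(*)$$ (a summand with $C_j=0$ is $0$, also if $L(j)\cup I(j)=\emptyset$). (i) If $A$ identifies the Copeland winner with confidence $1-\delta$ on the class of all $\mathbf P$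 without indifferences (i.e. $P_\cong=\mathbf 0$), then $(*)$ holds for every $\mathbf P$ without indifferences with a unique Copeland winner, $\mathcal C(\mathbf P)=\{i^*\}$, where $$C_j=\max\Big\{\frac{|L(j)|}{d_j+1}\mathbf 1\{|L(j)|\ge d_j+1\},\ \frac{|L(j)|-1}{|L(j)|+d_j-2}\mathbf 1\{i^*\in L(j)\}\Big\},\qquad D_{j,k}(\mathbf P)=\mathrm{kl}\big(P_\succ^{(j,k)},1-P_\succ^{(j,k)}\big),$$ and the second quotient is read as $1$ if $d_j=1$ (also if $|L(j)|=1$). (ii) If $A$ identifies the Copeland winner with confidence $1-\delta$ on the class of all $\mathbf P$, then $(*)$ holds for every $\mathbf P$ with $\mathcal C(\mathbf P)=\{i^*\}$ and $P_\succ^{(j,k)},P_\cong^{(j,k)},P_\prec^{(j,k)}>0$ for all $j\ne k$, where $$C_j=\max_{(i,l)\in\Psi(j)}\frac{\binom{|I(j)|}{i}\binom{|L(j)|}{l}}{\binom{|I(j)|-1}{i-1}\binom{|L(j)|}{l}\mathbf 1\{i\ge1\}+\binom{|I(j)|}{i}\binom{|L(j)|-1}{l-1}\mathbf 1\{l\ge1\}}$$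 with $\Psi(j)=\{(i,l):0\le i\le|I(j)|,\ 0\le l\le|L(j)|,\ i+2l\ge 2d_j+1\}$ (and $C_j=0$ if $\Psi(j)=\emptyset$), and $$D_{j,k}(\mathbf P)=\max\Big\{\mathrm{KL}\big((P_\succ^{(j,k)},P_\cong^{(j,k)},P_\prec^{(j,k)}),(P_\cong^{(j,k)},P_\succ^{(j,k)},P_\prec^{(j,k)})\big),\ \mathrm{KL}\big((P_\succ^{(j,k)},P_\cong^{(j,k)},P_\prec^{(j,k)}),(P_\prec^{(j,k)},P_\cong^{(j,k)},P_\succ^{(j,k)})\big)\Big\}.$$ -/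

import Mathlib

open MeasureTheory
open scoped ENNReal NNReal

universe u

/-- The three possible observations when the ordered pair `(i, j)` is duelled:
`succ` is `i ≻ j`, `indiff` is `i ≅ j`, `prec` is `i ≺ j`. -/
inductive Feedback : Type
  | succ
  | indiff
  | prec

instance : MeasurableSpace Feedback := ⊤

/-- A dueling bandits problem with indifferences on the arms `Fin n`: the three matrices
`P_≻`, `P_≅`, `P_≺` of probabilities, `P_≺` being the transpose of `P_≻`. -/
structure DuelingProblem (n : ℕ) where
  pSucc : Fin n → Fin n → ℝ
  pIndiff : Fin n → Fin n → ℝ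
  pPrec : Fin n → Fin n → ℝ
  pSucc_nonneg : ∀ i j, 0 ≤ pSucc i j
  pIndiff_nonneg : ∀ i j, 0 ≤ pIndiff i j
  pPrec_nonneg : ∀ i j, 0 ≤ pPrec i j
  sum_eq_one : ∀ i j, pSucc i j + pIndiff i j + pPrec i j = 1
  pSucc_swap : ∀ i j, pSucc j i = pPrec i j

namespace DuelingProblem

variable {n : ℕ} (P : DuelingProblem n)

/-- The law of the feedback of the duel `(i, j)`. -/
noncomputable def feedbackLaw (i j : Fin n) : Measure Feedback :=
  ENNReal.ofReal (P.pSucc i j) • Measure.dirac Feedback.succ +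
    ENNReal.ofReal (P.pIndiff i j) • Measure.dirac Feedback.indiff +
    ENNReal.ofReal (P.pPrec i j) • Measure.dirac Feedback.prec

instance isProbabilityMeasure_feedbackLaw (i j : Fin n) :
    IsProbabilityMeasure (P.feedbackLaw i j) := by
  constructor
  have h1 := P.pSucc_nonneg i j
  have h2 := P.pIndiff_nonneg i j
  have h3 := P.pPrec_nonneg i j
  simp only [feedbackLaw, Measure.coe_add, Measure.coe_smul, Pi.add_apply, Pi.smul_apply,
    measure_univ, smul_eq_mul, mul_one]
  rw [← ENNReal.ofReal_add h1 h2, ← ENNReal.ofReal_add (add_nonneg h1 h2) h3, P.sum_eq_one,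
    ENNReal.ofReal_one]

open Classical in
/-- The set `L(j)` of the arms that are superior to `j`. -/
noncomputable def superior (j : Fin n) : Finset (Fin n) :=
  Finset.univ.filter fun i => i ≠ j ∧ max (P.pPrec i j) (P.pIndiff i j) < P.pSucc i j

open Classical in
/-- The set `I(j)` of the arms that are indifferent to `j`. -/
noncomputable def indifferent (j : Fin n) : Finset (Fin n) :=
  Finset.univ.filter fun i => i ≠ j ∧ max (P.pPrec i j) (P.pSucc i j) < P.pIndiff i j

open Classical in
/-- The Copeland score `CP(i)`. -/
noncomputable def copelandScore (i : Fin n) : ℝ :=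
  (∑ j ∈ Finset.univ.erase i,
      if max (P.pPrec i j) (P.pIndiff i j) < P.pSucc i j then (1 : ℝ) else 0) +
    1 / 2 * ∑ j ∈ Finset.univ.erase i,
      if max (P.pSucc i j) (P.pPrec i j) < P.pIndiff i j then (1 : ℝ) else 0

/-- The set of Copeland winners. -/
def copelandSet : Set (Fin n) :=
  {i | P.copelandScore i = ⨆ j, P.copelandScore j}

/-- The gap `d_j` between the largest Copeland score and the score of `j`. -/
noncomputable def gap (j : Fin n) : ℝ :=
  (⨆ i, P.copelandScore i) - P.copelandScore j

/-- `P_≅` is the zero matrix. -/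
def NoIndifferences : Prop := ∀ i j, P.pIndiff i j = 0

end DuelingProblem

open Classical in
/-- The Kullback-Leibler divergence `KL(p, q)` of two categorical distributions (probability
vectors). The sum is then nonnegative, and a term with `p i = 0` is `0`. -/
noncomputable def categoricalKL {K : ℕ} (p q : Fin K → ℝ) : ℝ≥0∞ :=
  if ∀ i, q i = 0 → p i = 0 then ENNReal.ofReal (∑ i, p i * Real.log (p i / q i)) else ⊤

/-- The divergence `kl(p, q)` of two Bernoulli distributions with parameters `p` and `q`. -/
noncomputable def bernoulliKL (p q : ℝ) : ℝ≥0∞ :=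
  categoricalKL ![p, 1 - p] ![q, 1 - q]

namespace DuelingProblem

variable {n : ℕ} (P : DuelingProblem n)

/-- `D_{j,k}` for problems without indifferences. -/
noncomputable def divNoIndiff (j k : Fin n) : ℝ≥0∞ :=
  bernoulliKL (P.pSucc j k) (1 - P.pSucc j k)

open Classical in
/-- `C_j` for problems without indifferences with Copeland winner `w`. The quotient
`(|L(j)| - 1) / (|L(j)| + d_j - 2)` has the value `1` for `d_j = 1`, also if `|L(j)| = 1`. -/
noncomputable def coeffNoIndiff (w j : Fin n) : ℝ :=
  max
    (if P.gap j + 1 ≤ ((P.superior j).card : ℝ) then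
      ((P.superior j).card : ℝ) / (P.gap j + 1) else 0)
    (if w ∈ P.superior j then
      (if P.gap j = 1 then 1 else
        (((P.superior j).card : ℝ) - 1) / (((P.superior j).card : ℝ) + P.gap j - 2))
      else 0)

/-- `D_{j,k}` for problems with indifferences. -/
noncomputable def divIndiff (j k : Fin n) : ℝ≥0∞ :=
  max
    (categoricalKL ![P.pSucc j k, P.pIndiff j k, P.pPrec j k]
      ![P.pIndiff j k, P.pSucc j k, P.pPrec j k])
    (categoricalKL ![P.pSucc j k, P.pIndiff j k, P.pPrec j k]
      ![P.pPrec j k, P.pIndiff j k, P.pSucc j k])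

open Classical in
/-- The set `Ψ(j)`. -/
noncomputable def psi (j : Fin n) : Finset (ℕ × ℕ) :=
  (Finset.range ((P.indifferent j).card + 1) ×ˢ Finset.range ((P.superior j).card + 1)).filter
    fun x => 2 * P.gap j + 1 ≤ (x.1 : ℝ) + 2 * (x.2 : ℝ)

/-- `C_j` for problems with indifferences; a maximum over the empty set is `0`. -/
noncomputable def coeffIndiff (j : Fin n) : ℝ≥0 :=
  (P.psi j).sup fun x =>
    (((P.indifferent j).card.choose x.1 : ℝ≥0) * ((P.superior j).card.choose x.2 : ℝ≥0)) /
      ((if 1 ≤ x.1 then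
          (((P.indifferent j).card - 1).choose (x.1 - 1) : ℝ≥0) *
            ((P.superior j).card.choose x.2 : ℝ≥0) else 0) +
        (if 1 ≤ x.2 then
          ((P.indifferent j).card.choose x.1 : ℝ≥0) *
            (((P.superior j).card - 1).choose (x.2 - 1) : ℝ≥0) else 0))

end DuelingProblem

/-- A (possibly randomized) sequential learning algorithm. Its internal randomness is a seed that
is drawn once, independently of all feedback. Given the seed and the list of the duels made so far
with their feedback, it either duels a further ordered pair of arms (`Sum.inl`) or stops and
outputs an arm (`Sum.inr`). -/
structure DuelingAlgorithm (n : ℕ) where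
  Seed : Type u
  seedSpace : MeasurableSpace Seed
  seedLaw : @Measure Seed seedSpace
  isProbabilityMeasure_seedLaw : @IsProbabilityMeasure Seed seedSpace seedLaw
  act : Seed → List ((Fin n × Fin n) × Feedback) → (Fin n × Fin n) ⊕ Fin n
  measurableSet_act : ∀ h a, @MeasurableSet Seed seedSpace {s | act s h = a}

namespace DuelingAlgorithm

variable {n : ℕ} (A : DuelingAlgorithm.{u} n)

instance : MeasurableSpace A.Seed := A.seedSpace

instance : IsProbabilityMeasure A.seedLaw := A.isProbabilityMeasure_seedLaw

/-- An outcome of the experiment: the seed, and for each round `t` and each ordered pair `(i, j)`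
the feedback that is observed if `(i, j)` is duelled in round `t`. -/
abbrev Outcome : Type u := A.Seed × (ℕ × Fin n × Fin n → Feedback)

/-- The probability measure on outcomes for the problem `P`: the seed and all entries of the
feedback table are independent, and the entries for `(i, j)` have the feedback law of `(i, j)`. -/
noncomputable def law (P : DuelingProblem n) : Measure A.Outcome :=
  A.seedLaw.prod (Measure.infinitePi fun x : ℕ × Fin n × Fin n => P.feedbackLaw x.2.1 x.2.2)

/-- The list of the duels made in the first `t` rounds with their feedback; it no longer changes
once the algorithm has stopped. -/
def history (ω : A.Outcome) : ℕ → List ((Fin n × Fin n) × Feedback)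
  | 0 => []
  | t + 1 =>
    match A.act ω.1 (history ω t) with
    | Sum.inl d => history ω t ++ [(d, ω.2 (t, d))]
    | Sum.inr _ => history ω t

/-- After `t` duels the algorithm has stopped with output `i`. -/
def StoppedWith (ω : A.Outcome) (t : ℕ) (i : Fin n) : Prop :=
  A.act ω.1 (A.history ω t) = Sum.inr i

/-- The number `τ` of duels made before stopping; `⊤` if the algorithm never stops. -/
noncomputable def numSamples (ω : A.Outcome) : ℕ∞ :=
  ⨅ (t : ℕ) (_ : ∃ i, A.StoppedWith ω t i), (t : ℕ∞)

/-- The expected number of samples on the problem `P`. -/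
noncomputable def expectedSamples (P : DuelingProblem n) : ℝ≥0∞ :=
  ∫⁻ ω, (A.numSamples ω : ℝ≥0∞) ∂(A.law P)

/-- On every problem of the class `S`, the probability that the algorithm outputs an arm that is
not a Copeland winner is at most `δ`. -/
def IdentifiesCopelandWinner (S : Set (DuelingProblem n)) (δ : ℝ) : Prop :=
  ∀ P ∈ S,
    A.law P {ω | ∃ t i, A.StoppedWith ω t i ∧ i ∉ P.copelandSet} ≤ ENNReal.ofReal δ

end DuelingAlgorithm

/-! Fix an arm `j` other than the winner `w` and alter only the laws of its duels, so that `w` is no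
longer a Copeland winner. An algorithm that is reliable on both problems has to tell them apart.
Hence the expected numbers of duels of the pairs {j, k}, weighted by the relative entropies between
old and new laws, sum to at least kl(δ, 1 - δ) ≥ log (1 / (2.4 δ))
(`le_sum_relEntropy_mul_expectedDuels`, `log_one_div_le`).

To depose `w` it suffices to raise the score of `j` by more than its gap: beating a superior arm
gains 1, beating an indifferent one gains 1/2. The inequality holds for every admissible choice of
`i` indifferent and `l` superior arms, and averaging over all choices gives the binomial quotients
(`choose_mul_choose_mul_le`). Without indifferences, the second quotient is at most 1, and the
constant 1 comes from letting `j` win all its duels.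

Finally the inequalities for the different `j` are added. A pair {j, k} may then be counted at both
ends. The total stays below the number of duels if the end `j` carries the weight `value (P.prob k
j)`, the score that `k` earns against `j`, because two arms share at most one point
(`sum_ofReal_value_mul_le`). An indifferent pair thus has weight 1/2 at each end, so an indifferent
arm must be beaten at half the divergence. The delicate estimate `exists_isWinningLaw_of_indiff`
provides this: instead of exchanging two probabilities, one averages them or passes to the uniform
law. -/

namespace Feedback

noncomputable instance : DecidableEq Feedback := Classical.decEq _

instance : Fintype Feedback :=
  ⟨⟨[succ, indiff, prec], by simp⟩, by rintro (_ | _ | _) <;> simp⟩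

instance : MeasurableSingletonClass Feedback := ⟨fun _ => trivial⟩

instance : Inhabited Feedback := ⟨succ⟩

theorem sum_eq {M : Type*} [AddCommMonoid M] (f : Feedback → M) :
    ∑ x, f x = f succ + f indiff + f prec := by
  have : (Finset.univ : Finset Feedback) = {succ, indiff, prec} := by
    ext x; cases x <;> simp
  rw [this, Finset.sum_insert (by simp), Finset.sum_insert (by simp), Finset.sum_singleton,
    add_assoc]

end Feedback

/-! ### Relative entropy and its variational inequality -/

/-- The relative entropy of two finite families of weights. -/
noncomputable def relEntropy {ι : Type*} [Fintype ι] (p q : ι → ℝ) : ℝ :=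
  ∑ x, p x * Real.log (p x / q x)

theorem relEntropy_self {ι : Type*} [Fintype ι] (p : ι → ℝ) : relEntropy p p = 0 := by
  refine Finset.sum_eq_zero fun x _ => ?_
  by_cases h : p x = 0
  · simp [h]
  · simp [div_self h]

/-- The Donsker–Varadhan inequality for finite families. -/
theorem sum_mul_sub_relEntropy_le {ι : Type*} [Fintype ι] {p q : ι → ℝ} (hp : ∀ x, 0 ≤ p x)
    (hq : ∀ x, 0 ≤ q x) (hp1 : ∑ x, p x = 1) (hac : ∀ x, q x = 0 → p x = 0) (f : ι → ℝ) :
    ∑ x, p x * f x - relEntropy p q ≤ Real.log (∑ x, q x * Real.exp (f x)) := by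
  set M := ∑ x, q x * Real.exp (f x) with hM
  have hnn : ∀ x, 0 ≤ q x * Real.exp (f x) := fun x => mul_nonneg (hq x) (Real.exp_pos _).le
  have hMpos : 0 < M := by
    obtain ⟨x, hx⟩ : ∃ x, p x ≠ 0 := by
      by_contra! h
      simp [h] at hp1
    have hqx : 0 < q x := lt_of_le_of_ne (hq x) fun h => hx (hac x h.symm)
    exact lt_of_lt_of_le (mul_pos hqx (Real.exp_pos _))
      (Finset.single_le_sum (fun x _ => hnn x) (Finset.mem_univ x))
  -- This is log y ≤ y - 1 at y = q e^f / (M p), multiplied by p. The right-hand sides sum to 1 - 1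
  -- = 0.
  have key : ∀ x, p x * f x - p x * Real.log (p x / q x) - p x * Real.log M ≤
      q x * Real.exp (f x) / M - p x := by
    intro x
    rcases (hp x).eq_or_lt with h | h
    · rw [← h]
      simpa using div_nonneg (hnn x) hMpos.le
    · have hqx : 0 < q x := lt_of_le_of_ne (hq x) fun h' => h.ne' (hac x h'.symm)
      have h1 : Real.log (q x * Real.exp (f x) / (M * p x)) ≤
          q x * Real.exp (f x) / (M * p x) - 1 :=
        Real.log_le_sub_one_of_pos (by positivity)
      rw [Real.log_div (by positivity) (by positivity), Real.log_mul hqx.ne' (Real.exp_ne_zero _),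
        Real.log_exp, Real.log_mul hMpos.ne' h.ne'] at h1
      rw [Real.log_div h.ne' hqx.ne']
      have h2 := mul_le_mul_of_nonneg_left h1 h.le
      have h3 : p x * (q x * Real.exp (f x) / (M * p x) - 1) =
          q x * Real.exp (f x) / M - p x := by
        field_simp
      nlinarith
  have h := Finset.sum_le_sum fun x (_ : x ∈ Finset.univ) => key x
  simp only [Finset.sum_sub_distrib, ← Finset.sum_mul, ← Finset.sum_div, hp1, ← hM] at h
  rw [div_self hMpos.ne'] at h
  unfold relEntropy
  linarith

/-! ### The law of the feedback table -/

namespace DuelingProblem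

variable {n : ℕ} (P : DuelingProblem n)

/-- The probabilities of the three observations when `(i, j)` is duelled. -/
def prob (i j : Fin n) : Feedback → ℝ
  | .succ => P.pSucc i j
  | .indiff => P.pIndiff i j
  | .prec => P.pPrec i j

theorem prob_nonneg (i j : Fin n) (x : Feedback) : 0 ≤ P.prob i j x := by
  cases x
  exacts [P.pSucc_nonneg i j, P.pIndiff_nonneg i j, P.pPrec_nonneg i j]

theorem sum_prob (i j : Fin n) : ∑ x, P.prob i j x = 1 := by
  rw [Feedback.sum_eq]
  exact P.sum_eq_one i j

theorem integral_feedbackLaw (i j : Fin n) (g : Feedback → ℝ) :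
    ∫ x, g x ∂(P.feedbackLaw i j) = ∑ x, P.prob i j x * g x := by
  have h : ∀ x, P.feedbackLaw i j {x} = ENNReal.ofReal (P.prob i j x) := by
    intro x
    cases x <;> simp [feedbackLaw, prob]
  rw [integral_fintype .of_finite]
  refine Finset.sum_congr rfl fun x _ => ?_
  rw [measureReal_def, h, ENNReal.toReal_ofReal (P.prob_nonneg i j x), smul_eq_mul]

/-- The law of the feedback table. -/
noncomputable def tableLaw : Measure (ℕ × Fin n × Fin n → Feedback) :=
  Measure.infinitePi fun x : ℕ × Fin n × Fin n => P.feedbackLaw x.2.1 x.2.2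

instance : IsProbabilityMeasure P.tableLaw := by
  unfold tableLaw; infer_instance

theorem integral_tableLaw_eval (x : ℕ × Fin n × Fin n) (g : Feedback → ℝ) :
    ∫ ω, g (ω x) ∂P.tableLaw = ∑ y, P.prob x.2.1 x.2.2 y * g y := by
  rw [← integral_feedbackLaw,
    ← Measure.infinitePi_map_eval (fun x : ℕ × Fin n × Fin n => P.feedbackLaw x.2.1 x.2.2) x,
    integral_map (measurable_pi_apply x).aemeasurable
      (Measurable.of_discrete.aestronglyMeasurable)]
  rfl

end DuelingProblem

/-! ### Change of measure along the history -/

/-- Histories carry the discrete σ-algebra. -/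
instance historySpace (n : ℕ) : MeasurableSpace (List ((Fin n × Fin n) × Feedback)) := ⊤

instance (n : ℕ) : DiscreteMeasurableSpace (List ((Fin n × Fin n) × Feedback)) :=
  ⟨fun _ => trivial⟩

namespace DuelingAlgorithm

variable {n : ℕ} (A : DuelingAlgorithm.{u} n)

/-- The history after one more round with feedback `x`. -/
def extend (s : A.Seed) (h : List ((Fin n × Fin n) × Feedback)) (x : Fin n × Fin n → Feedback) :
    List ((Fin n × Fin n) × Feedback) :=
  match A.act s h with
  | Sum.inl d => h ++ [(d, x d)]
  | Sum.inr _ => h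

theorem history_succ (ω : A.Outcome) (t : ℕ) :
    A.history ω (t + 1) = A.extend ω.1 (A.history ω t) fun d => ω.2 (t, d) := rfl

theorem history_congr (s : A.Seed) {ω ω' : ℕ × Fin n × Fin n → Feedback} {t : ℕ}
    (h : ∀ r < t, ∀ d, ω (r, d) = ω' (r, d)) : A.history (s, ω) t = A.history (s, ω') t := by
  induction t with
  | zero => rfl
  | succ t ih =>
    rw [history_succ, history_succ, ih fun r hr => h r (hr.trans t.lt_succ_self)]
    congr 1
    funext d
    exact h t t.lt_succ_self d

/-- The cells of the feedback table that belong to the first `t` rounds. -/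
def pastCells (n t : ℕ) : Finset (ℕ × Fin n × Fin n) := Finset.range t ×ˢ Finset.univ

open Classical in
/-- The history as a function of the relevant part of the feedback table. -/
noncomputable def historyOfPast (s : A.Seed) (t : ℕ) (y : pastCells n t → Feedback) :
    List ((Fin n × Fin n) × Feedback) :=
  A.history (s, fun c => if hc : c ∈ pastCells n t then y ⟨c, hc⟩ else default) t

theorem history_eq_historyOfPast (s : A.Seed) (ω : ℕ × Fin n × Fin n → Feedback) (t : ℕ) :
    A.history (s, ω) t = A.historyOfPast s t fun c => ω c := by
  refine A.history_congr s fun r hr d => ?_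
  rw [dif_pos]
  simp [pastCells, hr]

theorem measurable_history_table (s : A.Seed) (t : ℕ) :
    Measurable fun ω : ℕ × Fin n × Fin n → Feedback => A.history (s, ω) t := by
  simp only [A.history_eq_historyOfPast s]
  exact (Measurable.of_discrete (f := A.historyOfPast s t)).comp (by fun_prop)

/-- For a fixed seed the history factors through finitely many cells of the table, hence through a
finite type, so `g` needs no bound. -/
theorem integrable_comp_history (P : DuelingProblem n) (s : A.Seed) (t : ℕ)
    (g : List ((Fin n × Fin n) × Feedback) → ℝ) :
    Integrable (fun ω => g (A.history (s, ω) t)) P.tableLaw := by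
  simp only [A.history_eq_historyOfPast s]
  have hm : Measurable fun (ω : ℕ × Fin n × Fin n → Feedback) (c : pastCells n t) => ω c := by
    fun_prop
  have : Integrable (fun y => g (A.historyOfPast s t y))
      (P.tableLaw.map fun ω (c : pastCells n t) => ω c) := .of_finite
  exact (integrable_map_measure this.aestronglyMeasurable hm.aemeasurable).1 this

theorem indepFun_history (P : DuelingProblem n) (s : A.Seed) (t : ℕ) :
    ProbabilityTheory.IndepFun (fun ω => A.history (s, ω) t)
      (fun ω (d : Fin n × Fin n) => ω (t, d)) P.tableLaw := by
  have h := ProbabilityTheory.iIndepFun_infinitePi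
    (P := fun x : ℕ × Fin n × Fin n => P.feedbackLaw x.2.1 x.2.2)
    (X := fun _ => id) (fun _ => measurable_id)
  have h2 := h.indepFun_finset (pastCells n t) ({t} ×ˢ Finset.univ)
    (by
      rw [Finset.disjoint_left]
      rintro ⟨r, d⟩ h1 h2
      simp [pastCells] at h1 h2
      omega)
    (fun _ => by fun_prop)
  have h3 := h2.comp (φ := A.historyOfPast s t)
    (ψ := fun y (d : Fin n × Fin n) => y ⟨(t, d), by simp⟩) .of_discrete .of_discrete
  convert h3 using 1
  · funext ω
    exact A.history_eq_historyOfPast s ω t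
  · rfl
  · rfl

/-- The expectation of `g` after one more round. -/
noncomputable def step (P : DuelingProblem n) (s : A.Seed)
    (g : List ((Fin n × Fin n) × Feedback) → ℝ) (h : List ((Fin n × Fin n) × Feedback)) : ℝ :=
  match A.act s h with
  | Sum.inl d => ∑ x, P.prob d.1 d.2 x * g (h ++ [(d, x)])
  | Sum.inr _ => g h

/-- The Markov property: the row `t` of the table is independent of the history that decides which
of its cells is read. -/
theorem integral_history_succ (P : DuelingProblem n) (s : A.Seed) (t : ℕ)
    (g : List ((Fin n × Fin n) × Feedback) → ℝ) :
    ∫ ω, g (A.history (s, ω) (t + 1)) ∂P.tableLaw =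
      ∫ ω, A.step P s g (A.history (s, ω) t) ∂P.tableLaw := by
  have hH := A.measurable_history_table s t
  have hX : Measurable fun (ω : ℕ × Fin n × Fin n → Feedback) (d : Fin n × Fin n) => ω (t, d) := by
    fun_prop
  set Φ : List ((Fin n × Fin n) × Feedback) × (Fin n × Fin n → Feedback) → ℝ :=
    fun z => g (A.extend s z.1 z.2) with hΦ
  have hΦm : Measurable Φ := .of_discrete
  have hmap := (A.indepFun_history P s t).map_prod_eq_prod_map_map hH.aemeasurable hX.aemeasurable
  have hint : Integrable Φ (P.tableLaw.map fun ω =>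
      (A.history (s, ω) t, fun d : Fin n × Fin n => ω (t, d))) :=
    (integrable_map_measure hΦm.aestronglyMeasurable (hH.prodMk hX).aemeasurable).2
      (A.integrable_comp_history P s (t + 1) g)
  calc ∫ ω, g (A.history (s, ω) (t + 1)) ∂P.tableLaw
      = ∫ z, Φ z ∂(P.tableLaw.map fun ω =>
          (A.history (s, ω) t, fun d : Fin n × Fin n => ω (t, d))) := by
        rw [integral_map (hH.prodMk hX).aemeasurable hΦm.aestronglyMeasurable]
        rfl
    _ = ∫ h, ∫ x, Φ (h, x) ∂(P.tableLaw.map fun ω (d : Fin n × Fin n) => ω (t, d))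
          ∂(P.tableLaw.map fun ω => A.history (s, ω) t) := by
        rw [hmap] at hint ⊢
        have := Measure.isProbabilityMeasure_map (μ := P.tableLaw) hX.aemeasurable
        have := Measure.isProbabilityMeasure_map (μ := P.tableLaw) hH.aemeasurable
        exact integral_prod _ hint
    _ = ∫ h, A.step P s g h ∂(P.tableLaw.map fun ω => A.history (s, ω) t) := by
        congr 1
        funext h
        rw [integral_map hX.aemeasurable Measurable.of_discrete.aestronglyMeasurable]
        simp only [hΦ, extend, step]
        cases A.act s h with
        | inl d => exact P.integral_tableLaw_eval (t, d) fun x => g (h ++ [(d, x)])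
        | inr _ => simp
    _ = _ := by
        rw [integral_map hH.aemeasurable Measurable.of_discrete.aestronglyMeasurable]

/-- The sum of the costs `κ` of the duels in a history. -/
noncomputable def totalCost (κ : Fin n × Fin n → ℝ) (h : List ((Fin n × Fin n) × Feedback)) : ℝ :=
  (h.map fun z => κ z.1).sum

/-- Donsker–Varadhan for whole histories. The weaker right-hand side, with E - 1 in place of log E,
is linear in the expectation and can therefore be integrated over the seed without a convexity
argument. -/
theorem integral_sub_totalCost_le (P Q : DuelingProblem n) (s : A.Seed)
    (hac : ∀ i j x, Q.prob i j x = 0 → P.prob i j x = 0) (t : ℕ)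
    (f : List ((Fin n × Fin n) × Feedback) → ℝ) :
    ∫ ω, (f (A.history (s, ω) t) - totalCost
        (fun d => relEntropy (P.prob d.1 d.2) (Q.prob d.1 d.2)) (A.history (s, ω) t)) ∂P.tableLaw ≤
      ∫ ω, Real.exp (f (A.history (s, ω) t)) ∂Q.tableLaw - 1 := by
  set κ : Fin n × Fin n → ℝ := fun d => relEntropy (P.prob d.1 d.2) (Q.prob d.1 d.2) with hκ
  induction t generalizing f with
  | zero =>
    simp only [history, integral_const, totalCost]
    simp only [probReal_univ, List.map_nil, List.sum_nil, sub_zero, one_smul]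
    linarith [Real.add_one_le_exp (f [])]
  | succ t ih =>
    -- The function exp f' is the one-step expectation of exp f under `Q`. The one-step variational
    -- inequality then says that a round under `P` turns f into at most f', once the relative
    -- entropy of the duel is paid.
    set f' : List ((Fin n × Fin n) × Feedback) → ℝ :=
      fun h => Real.log (A.step Q s (fun h => Real.exp (f h)) h) with hf'
    have hpos : ∀ h, 0 < A.step Q s (fun h => Real.exp (f h)) h := by
      intro h
      unfold step
      cases A.act s h with
      | inl d =>
        obtain ⟨x, hx⟩ : ∃ x, Q.prob d.1 d.2 x ≠ 0 := by
          by_contra! h'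
          have := Q.sum_prob d.1 d.2
          simp [h'] at this
        have hx' := lt_of_le_of_ne (Q.prob_nonneg d.1 d.2 x) hx.symm
        exact lt_of_lt_of_le (mul_pos hx' (Real.exp_pos (f (h ++ [(d, x)]))))
          (Finset.single_le_sum (f := fun x => Q.prob d.1 d.2 x * Real.exp (f (h ++ [(d, x)])))
            (fun x _ => mul_nonneg (Q.prob_nonneg d.1 d.2 x) (Real.exp_pos _).le)
            (Finset.mem_univ x))
      | inr _ => exact Real.exp_pos _
    have hle : ∀ h, A.step P s (fun h => f h - totalCost κ h) h ≤ f' h - totalCost κ h := by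
      intro h
      simp only [hf', step]
      cases A.act s h with
      | inl d =>
        have h1 := sum_mul_sub_relEntropy_le (P.prob_nonneg d.1 d.2) (Q.prob_nonneg d.1 d.2)
          (P.sum_prob d.1 d.2) (hac d.1 d.2) fun x => f (h ++ [(d, x)])
        have h2 : ∀ x, totalCost κ (h ++ [(d, x)]) = totalCost κ h + κ d := by
          intro x
          simp [totalCost]
        simp only [h2, mul_sub, Finset.sum_sub_distrib, ← Finset.sum_mul, P.sum_prob, one_mul]
        have h3 : κ d = relEntropy (P.prob d.1 d.2) (Q.prob d.1 d.2) := rfl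
        linarith
      | inr _ => simp
    rw [A.integral_history_succ P s t fun h => f h - totalCost κ h,
      A.integral_history_succ Q s t fun h => Real.exp (f h)]
    refine (integral_mono (A.integrable_comp_history P s t _)
      (A.integrable_comp_history P s t fun h => f' h - totalCost κ h) fun ω => hle _).trans ?_
    refine (ih f').trans (le_of_eq ?_)
    simp only [hf', Real.exp_log (hpos _)]

end DuelingAlgorithm

theorem relEntropy_nonneg {ι : Type*} [Fintype ι] {p q : ι → ℝ} (hp : ∀ x, 0 ≤ p x)
    (hq : ∀ x, 0 ≤ q x) (hp1 : ∑ x, p x = 1) (hq1 : ∑ x, q x = 1)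
    (hac : ∀ x, q x = 0 → p x = 0) : 0 ≤ relEntropy p q := by
  have := sum_mul_sub_relEntropy_le hp hq hp1 hac fun _ => 0
  simp [hq1] at this
  exact this

instance {α β : Type*} [MeasurableSpace α] [MeasurableSpace β] [MeasurableSingletonClass α]
    [MeasurableSingletonClass β] : MeasurableSingletonClass (α ⊕ β) := by
  refine ⟨?_⟩
  rintro (a | b)
  · simpa using (measurableSet_singleton a).inl_image (β := β)
  · simpa using (measurableSet_singleton b).inr_image (α := α)

/-! ### Stopping, numbers of duels, and the information inequality -/

namespace DuelingAlgorithm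

variable {n : ℕ} (A : DuelingAlgorithm.{u} n)

theorem law_eq (P : DuelingProblem n) : A.law P = A.seedLaw.prod P.tableLaw := rfl

instance (P : DuelingProblem n) : IsProbabilityMeasure (A.law P) := by
  rw [law_eq]; infer_instance

theorem measurable_act (h : List ((Fin n × Fin n) × Feedback)) :
    Measurable fun s : A.Seed => A.act s h :=
  measurable_to_countable' fun a => A.measurableSet_act h a

theorem measurable_history (t : ℕ) : Measurable fun ω : A.Outcome => A.history ω t := by
  induction t with
  | zero => exact measurable_const
  | succ t ih =>
    have h : Measurable fun z : List ((Fin n × Fin n) × Feedback) × A.Outcome =>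
        A.extend z.2.1 z.1 fun d => z.2.2 (t, d) := by
      refine measurable_from_prod_countable_right fun h => ?_
      have h1 : Measurable fun ω : A.Outcome =>
          (A.act ω.1 h, fun d : Fin n × Fin n => ω.2 (t, d)) :=
        ((A.measurable_act h).comp measurable_fst).prodMk (by fun_prop)
      exact (Measurable.of_discrete (f := fun z : ((Fin n × Fin n) ⊕ Fin n) ×
        (Fin n × Fin n → Feedback) => (match z.1 with
          | Sum.inl d => h ++ [(d, z.2 d)]
          | Sum.inr _ => h))).comp h1
    exact h.comp (ih.prodMk measurable_id)

theorem measurableSet_stoppedWith (t : ℕ) (i : Fin n) :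
    MeasurableSet {ω : A.Outcome | A.StoppedWith ω t i} := by
  have h : Measurable fun z : List ((Fin n × Fin n) × Feedback) × A.Outcome =>
      A.act z.2.1 z.1 :=
    measurable_from_prod_countable_right fun h => (A.measurable_act h).comp measurable_fst
  exact (h.comp ((A.measurable_history t).prodMk measurable_id)) (measurableSet_singleton (Sum.inr i))

theorem length_history_le (ω : A.Outcome) (t : ℕ) : (A.history ω t).length ≤ t := by
  induction t with
  | zero => simp [history]
  | succ t ih =>
    rw [history_succ, extend]
    cases A.act ω.1 (A.history ω t) with
    | inl d => simpa using ih
    | inr _ => exact ih.trans t.le_succ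

theorem history_eq_of_stoppedWith {ω : A.Outcome} {t : ℕ} {i : Fin n} (h : A.StoppedWith ω t i)
    {r : ℕ} (hr : t ≤ r) : A.history ω r = A.history ω t := by
  induction r, hr using Nat.le_induction with
  | base => rfl
  | succ r hr ih =>
    rw [history_succ, ih, extend, show A.act ω.1 (A.history ω t) = Sum.inr i from h]

theorem StoppedWith.mono {A : DuelingAlgorithm.{u} n} {ω : A.Outcome} {t : ℕ} {i : Fin n}
    (h : A.StoppedWith ω t i) {r : ℕ} (hr : t ≤ r) : A.StoppedWith ω r i := by
  unfold StoppedWith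
  rw [A.history_eq_of_stoppedWith h hr]
  exact h

theorem length_history_le_numSamples (ω : A.Outcome) (t : ℕ) :
    ((A.history ω t).length : ℕ∞) ≤ A.numSamples ω := by
  refine le_iInf₂ fun r hr => ?_
  obtain ⟨i, hi⟩ := hr
  rw [Nat.cast_le]
  rcases le_total t r with h | h
  · exact (A.length_history_le ω t).trans h
  · rw [A.history_eq_of_stoppedWith hi h]
    exact A.length_history_le ω r

/-- The number of duels of the ordered pair `d` in a history. -/
def duelCount (d : Fin n × Fin n) (h : List ((Fin n × Fin n) × Feedback)) : ℕ :=
  (h.map Prod.fst).count d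

theorem sum_duelCount (h : List ((Fin n × Fin n) × Feedback)) :
    ∑ d, duelCount d h = h.length := by
  induction h with
  | nil => simp [duelCount]
  | cons z h ih =>
    simp only [duelCount, List.map_cons, List.count_cons, List.length_cons] at ih ⊢
    rw [Finset.sum_add_distrib, ih]
    simp

theorem totalCost_eq_sum (κ : Fin n × Fin n → ℝ) (h : List ((Fin n × Fin n) × Feedback)) :
    totalCost κ h = ∑ d, κ d * duelCount d h := by
  induction h with
  | nil => simp [duelCount, totalCost]
  | cons z h ih =>
    simp only [duelCount, totalCost, List.map_cons, List.count_cons, List.sum_cons] at ih ⊢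
    rw [ih]
    push_cast
    simp only [mul_add, Finset.sum_add_distrib]
    simp [add_comm]

theorem duelCount_history_le_succ (d : Fin n × Fin n) (ω : A.Outcome) (t : ℕ) :
    duelCount d (A.history ω t) ≤ duelCount d (A.history ω (t + 1)) := by
  rw [history_succ, extend]
  cases A.act ω.1 (A.history ω t) with
  | inl d => simp [duelCount]
  | inr _ => exact le_rfl

/-- The total number of duels of the ordered pair `d`. -/
noncomputable def numDuels (ω : A.Outcome) (d : Fin n × Fin n) : ℝ≥0∞ :=
  ⨆ t, (duelCount d (A.history ω t) : ℝ≥0∞)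

/-- The expected number of duels of the ordered pair `d`. -/
noncomputable def expectedDuels (P : DuelingProblem n) (d : Fin n × Fin n) : ℝ≥0∞ :=
  ∫⁻ ω, A.numDuels ω d ∂A.law P

theorem measurable_duelCount_history (d : Fin n × Fin n) (t : ℕ) :
    Measurable fun ω : A.Outcome => duelCount d (A.history ω t) :=
  (Measurable.of_discrete (f := duelCount d)).comp (A.measurable_history t)

theorem measurable_numDuels (d : Fin n × Fin n) :
    Measurable fun ω : A.Outcome => A.numDuels ω d :=
  Measurable.iSup fun t =>
    (Measurable.of_discrete (f := fun k : ℕ => (k : ℝ≥0∞))).comp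
      (A.measurable_duelCount_history d t)

theorem sum_numDuels_le (ω : A.Outcome) : ∑ d, A.numDuels ω d ≤ (A.numSamples ω : ℝ≥0∞) := by
  unfold numDuels
  rw [ENNReal.finsetSum_iSup_of_monotone fun d =>
    monotone_nat_of_le_succ fun t => by exact_mod_cast A.duelCount_history_le_succ d ω t]
  refine iSup_le fun t => ?_
  rw [← Nat.cast_sum, sum_duelCount]
  exact_mod_cast ENat.toENNReal_le.2 (A.length_history_le_numSamples ω t)

theorem sum_expectedDuels_le (P : DuelingProblem n) :
    ∑ d, A.expectedDuels P d ≤ A.expectedSamples P := by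
  unfold expectedDuels expectedSamples
  rw [← lintegral_finsetSum _ fun d _ => A.measurable_numDuels d]
  exact lintegral_mono fun ω => A.sum_numDuels_le ω

theorem integrable_duelCount (P : DuelingProblem n) (d : Fin n × Fin n) (t : ℕ) :
    Integrable (fun ω => (duelCount d (A.history ω t) : ℝ)) (A.law P) := by
  refine Integrable.of_bound ((Measurable.of_discrete (f := fun k : ℕ => (k : ℝ))).comp
      (A.measurable_duelCount_history d t)).aestronglyMeasurable t (Filter.Eventually.of_forall ?_)
  intro ω
  rw [Real.norm_of_nonneg (by positivity)]
  have h := (Finset.single_le_sum (f := fun d => duelCount d (A.history ω t)) (fun _ _ => zero_le)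
    (Finset.mem_univ d)).trans ((sum_duelCount _).le.trans (A.length_history_le ω t))
  exact_mod_cast h

theorem integral_duelCount_le (P : DuelingProblem n) (d : Fin n × Fin n) (t : ℕ)
    (hfin : A.expectedDuels P d ≠ ⊤) :
    ∫ ω, (duelCount d (A.history ω t) : ℝ) ∂A.law P ≤ (A.expectedDuels P d).toReal := by
  rw [integral_eq_lintegral_of_nonneg_ae (Filter.Eventually.of_forall fun ω => by positivity)
    (A.integrable_duelCount P d t).aestronglyMeasurable]
  refine ENNReal.toReal_mono hfin (lintegral_mono fun ω => ?_)
  rw [ENNReal.ofReal_natCast]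
  exact le_iSup (fun t => (duelCount d (A.history ω t) : ℝ≥0∞)) t

/-- The test function is c times the indicator of the event, minus log M. The free constant M makes
up for the loss in replacing log E by E - 1. -/
theorem mul_measureReal_stoppedWith_le (P Q : DuelingProblem n)
    (hac : ∀ i j x, Q.prob i j x = 0 → P.prob i j x = 0) (w : Fin n) (t : ℕ) (c : ℝ) {M : ℝ}
    (hM : 0 < M) :
    c * (A.law P).real {ω | A.StoppedWith ω t w} ≤
      ∑ d, relEntropy (P.prob d.1 d.2) (Q.prob d.1 d.2) *
          ∫ ω, (duelCount d (A.history ω t) : ℝ) ∂A.law P +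
        Real.log M +
        ((1 + (Real.exp c - 1) * (A.law Q).real {ω | A.StoppedWith ω t w}) / M - 1) := by
  set E : Set A.Outcome := {ω | A.StoppedWith ω t w} with hE
  have hEm : MeasurableSet E := A.measurableSet_stoppedWith t w
  set κ : Fin n × Fin n → ℝ := fun d => relEntropy (P.prob d.1 d.2) (Q.prob d.1 d.2) with hκ
  have hind : ∀ R : DuelingProblem n, Integrable (E.indicator fun _ => (1 : ℝ)) (A.law R) :=
    fun R => (integrable_const _).indicator hEm
  have hindint : ∀ R : DuelingProblem n,
      ∫ ω, E.indicator (fun _ => (1 : ℝ)) ω ∂A.law R = (A.law R).real E := by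
    intro R
    rw [integral_indicator_const _ hEm, smul_eq_mul, mul_one]
  set F : A.Outcome → ℝ := fun ω => c * E.indicator (fun _ => (1 : ℝ)) ω - Real.log M -
    ∑ d, κ d * (duelCount d (A.history ω t) : ℝ) with hF
  set G : A.Outcome → ℝ := fun ω => (1 + (Real.exp c - 1) * E.indicator (fun _ => (1 : ℝ)) ω) / M
    with hG
  have hcost : Integrable (fun ω => ∑ d, κ d * (duelCount d (A.history ω t) : ℝ)) (A.law P) :=
    integrable_finsetSum _ fun d _ => (A.integrable_duelCount P d t).const_mul _
  have hFi : Integrable F (A.law P) :=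
    (((hind P).const_mul c).sub (integrable_const _)).sub hcost
  have hGi : Integrable G (A.law Q) :=
    ((integrable_const _).add ((hind Q).const_mul _)).div_const _
  have hseed : ∀ s, ∫ ω, F (s, ω) ∂P.tableLaw ≤ ∫ ω, G (s, ω) ∂Q.tableLaw - 1 := by
    intro s
    classical
    have h := A.integral_sub_totalCost_le P Q s hac t
      fun h => (if A.act s h = Sum.inr w then c else 0) - Real.log M
    have e1 : ∀ ω, F (s, ω) = (if A.act s (A.history (s, ω) t) = Sum.inr w then c else 0) -
        Real.log M - totalCost κ (A.history (s, ω) t) := by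
      intro ω
      simp only [hF, totalCost_eq_sum, Set.indicator_apply, hE, Set.mem_ofPred_eq, StoppedWith]
      split_ifs <;> simp
    have e2 : ∀ ω, G (s, ω) = Real.exp ((if A.act s (A.history (s, ω) t) = Sum.inr w then c else 0)
        - Real.log M) := by
      intro ω
      rw [Real.exp_sub, Real.exp_log hM]
      simp only [hG, Set.indicator_apply, hE, Set.mem_ofPred_eq, StoppedWith]
      split_ifs <;> simp
    simpa only [e1, e2] using h
  have hmain : ∫ ω, F ω ∂A.law P ≤ ∫ ω, G ω ∂A.law Q - 1 := by
    rw [law_eq] at hFi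
    rw [law_eq] at hGi
    rw [law_eq, law_eq, integral_prod _ hFi, integral_prod _ hGi]
    have h1 : ∫ s, (∫ ω, G (s, ω) ∂Q.tableLaw - 1) ∂A.seedLaw =
        ∫ s, ∫ ω, G (s, ω) ∂Q.tableLaw ∂A.seedLaw - 1 := by
      rw [integral_sub hGi.integral_prod_left (integrable_const _)]
      simp
    rw [← h1]
    exact integral_mono hFi.integral_prod_left (hGi.integral_prod_left.sub (integrable_const _))
      hseed
  have hFint : ∫ ω, F ω ∂A.law P = c * (A.law P).real E - Real.log M -
      ∑ d, κ d * ∫ ω, (duelCount d (A.history ω t) : ℝ) ∂A.law P := by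
    have hi : Integrable (fun ω => c * E.indicator (fun _ => (1 : ℝ)) ω - Real.log M) (A.law P) :=
      ((hind P).const_mul c).sub (integrable_const _)
    simp only [hF]
    rw [integral_sub hi hcost, integral_sub ((hind P).const_mul c) (integrable_const _), integral_const_mul, hindint,
      integral_finsetSum _ fun d _ => (A.integrable_duelCount P d t).const_mul _]
    simp [integral_const_mul]
  have hGint : ∫ ω, G ω ∂A.law Q = (1 + (Real.exp c - 1) * (A.law Q).real E) / M := by
    simp only [hG]
    rw [integral_div, integral_add (integrable_const _) ((hind Q).const_mul _),
      integral_const_mul, hindint]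
    simp
  rw [hFint, hGint] at hmain
  linarith

/-- The algorithm never stops. -/
def NeverStops (ω : A.Outcome) : Prop := ∀ t i, ¬ A.StoppedWith ω t i

/-- On this event the number of samples is infinite, so positive probability would make its
expectation infinite. -/
theorem measure_neverStops (P : DuelingProblem n) (hfin : A.expectedSamples P ≠ ⊤) :
    A.law P {ω | A.NeverStops ω} = 0 := by
  have hm : MeasurableSet {ω | A.NeverStops ω} := by
    have : {ω | A.NeverStops ω} = ⋂ t, ⋂ i, {ω | A.StoppedWith ω t i}ᶜ := by
      ext ω; simp [NeverStops]
    rw [this]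
    exact .iInter fun t => .iInter fun i => (A.measurableSet_stoppedWith t i).compl
  by_contra h
  apply hfin
  rw [eq_top_iff]
  calc (⊤ : ℝ≥0∞) = ⊤ * A.law P {ω | A.NeverStops ω} := (ENNReal.top_mul h).symm
    _ = ∫⁻ ω, {ω | A.NeverStops ω}.indicator (fun _ => ⊤) ω ∂A.law P := by
      rw [lintegral_indicator_const hm]
    _ ≤ A.expectedSamples P := by
      refine lintegral_mono fun ω => ?_
      by_cases hω : A.NeverStops ω
      · have : A.numSamples ω = ⊤ := by
          unfold numSamples
          simp only [iInf_eq_top]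
          rintro t ⟨i, hi⟩
          exact absurd hi (hω t i)
        simp [this]
      · simp [hω]

/-- The change-of-measure inequality: a problem `Q` for which the winner of `P` is not a winner
can only be told apart from `P` if sufficiently many informative duels are made. -/
theorem le_sum_relEntropy_mul_expectedDuels {P Q : DuelingProblem n} {w : Fin n} {δ : ℝ}
    (hδ0 : 0 < δ) (hδ : δ < 1 / 2) (hfin : A.expectedSamples P ≠ ⊤)
    (hac : ∀ i j x, Q.prob i j x = 0 → P.prob i j x = 0)
    (hP : A.law P {ω | ∃ t i, A.StoppedWith ω t i ∧ i ∉ P.copelandSet} ≤ ENNReal.ofReal δ)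
    (hQ : A.law Q {ω | ∃ t i, A.StoppedWith ω t i ∧ i ∉ Q.copelandSet} ≤ ENNReal.ofReal δ)
    (hw : P.copelandSet = {w}) (hwQ : w ∉ Q.copelandSet) :
    (1 - 2 * δ) * Real.log ((1 - δ) / δ) ≤
      ∑ d, relEntropy (P.prob d.1 d.2) (Q.prob d.1 d.2) * (A.expectedDuels P d).toReal := by
  set M := (1 - δ) / δ with hM
  have hMpos : 0 < M := div_pos (by linarith) hδ0
  have hM1 : 1 ≤ M := by rw [hM, le_div_iff₀ hδ0]; linarith
  -- With this c the test function is the log-likelihood ratio of Bernoulli laws with parameters 1 -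
  -- δ and δ: log M on the event, -log M off it.
  set c := 2 * Real.log M with hc
  have hexp : Real.exp c = M ^ 2 := by
    rw [hc, two_mul, Real.exp_add, Real.exp_log hMpos, sq]
  set K := ∑ d, relEntropy (P.prob d.1 d.2) (Q.prob d.1 d.2) * (A.expectedDuels P d).toReal with hK
  have hdfin : ∀ d, A.expectedDuels P d ≠ ⊤ := fun d =>
    ne_top_of_le_ne_top hfin ((Finset.single_le_sum (fun _ _ => zero_le)
      (Finset.mem_univ d)).trans (A.sum_expectedDuels_le P))
  have hbound : ∀ t, c * (A.law P).real {ω | A.StoppedWith ω t w} ≤ K + Real.log M := by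
    intro t
    have h := A.mul_measureReal_stoppedWith_le P Q hac w t c hMpos
    have h1 : ∑ d, relEntropy (P.prob d.1 d.2) (Q.prob d.1 d.2) *
        ∫ ω, (duelCount d (A.history ω t) : ℝ) ∂A.law P ≤ K :=
      Finset.sum_le_sum fun d _ => mul_le_mul_of_nonneg_left
        (A.integral_duelCount_le P d t (hdfin d))
        (relEntropy_nonneg (P.prob_nonneg _ _) (Q.prob_nonneg _ _) (P.sum_prob _ _)
          (Q.sum_prob _ _) (hac _ _))
    have h2 : (A.law Q).real {ω | A.StoppedWith ω t w} ≤ δ := by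
      refine ENNReal.toReal_le_of_le_ofReal hδ0.le ((measure_mono ?_).trans hQ)
      exact fun ω hω => ⟨t, w, hω, hwQ⟩
    -- At probability exactly δ the numerator is 1 + (M² - 1) δ = (1 - δ)(1 + M) = M, so the bracket
    -- vanishes there.
    have h3 : (1 + (Real.exp c - 1) * (A.law Q).real {ω | A.StoppedWith ω t w}) / M - 1 ≤ 0 := by
      rw [sub_nonpos, div_le_one hMpos, hexp]
      have h4 : 0 ≤ M ^ 2 - 1 := by nlinarith
      have h5 := mul_le_mul_of_nonneg_left h2 h4
      have h6 : M * δ = 1 - δ := by rw [hM]; field_simp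
      have h7 : M ^ 2 * δ = M * (1 - δ) := by rw [sq, mul_assoc, h6]
      nlinarith
    linarith
  have hlim : Filter.Tendsto (fun t => (A.law P).real {ω | A.StoppedWith ω t w}) Filter.atTop
      (nhds ((A.law P).real (⋃ t, {ω | A.StoppedWith ω t w}))) := by
    refine (ENNReal.tendsto_toReal (measure_ne_top _ _)).comp
      (tendsto_measure_iUnion_atTop fun t r htr ω hω => ?_)
    exact StoppedWith.mono hω htr
  have hE : 1 - δ ≤ (A.law P).real (⋃ t, {ω | A.StoppedWith ω t w}) := by
    have hcover : (Set.univ : Set A.Outcome) ⊆ (⋃ t, {ω | A.StoppedWith ω t w}) ∪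
        ({ω | ∃ t i, A.StoppedWith ω t i ∧ i ∉ P.copelandSet} ∪ {ω | A.NeverStops ω}) := by
      intro ω _
      by_cases h : A.NeverStops ω
      · exact Or.inr (Or.inr h)
      · unfold NeverStops at h
        push Not at h
        obtain ⟨t, i, hi⟩ := h
        by_cases hiw : i = w
        · exact Or.inl (Set.mem_iUnion.2 ⟨t, hiw ▸ hi⟩)
        · exact Or.inr (Or.inl ⟨t, i, hi, by rw [hw]; exact hiw⟩)
    have h1 := (measure_mono (μ := A.law P) hcover).trans (measure_union_le _ _)
    have h2 := measure_union_le (μ := A.law P)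
      {ω | ∃ t i, A.StoppedWith ω t i ∧ i ∉ P.copelandSet} {ω | A.NeverStops ω}
    rw [A.measure_neverStops P hfin, add_zero] at h2
    rw [measure_univ] at h1
    have h3 := h1.trans (add_le_add_right (h2.trans hP) _)
    rw [← ofReal_measureReal, ← ENNReal.ofReal_add measureReal_nonneg hδ0.le,
      ENNReal.one_le_ofReal] at h3
    linarith
  have h := le_of_tendsto' (hlim.const_mul c) hbound
  have hlog : 0 ≤ Real.log M := Real.log_nonneg hM1
  nlinarith

end DuelingAlgorithm

/-- With u = 1 - δ the claim reads 2 (δ log δ + u log u) - log u + log 2.4 ≥ 0. The logarithms are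
replaced by tangent bounds at δ = 10/31, close to the minimiser. -/
theorem log_one_div_le {δ : ℝ} (hδ0 : 0 < δ) (hδ : δ < 1 / 2) :
    Real.log (1 / (2.4 * δ)) ≤ (1 - 2 * δ) * Real.log ((1 - δ) / δ) := by
  have hu : 0 < 1 - δ := by linarith
  have h1 : Real.log (10 / 31 / δ) ≤ 10 / 31 / δ - 1 := Real.log_le_sub_one_of_pos (by positivity)
  have h2 : Real.log (21 / 31 / (1 - δ)) ≤ 21 / 31 / (1 - δ) - 1 :=
    Real.log_le_sub_one_of_pos (by positivity)
  have h3 : Real.log ((1 - δ) / (21 / 31)) ≤ (1 - δ) / (21 / 31) - 1 :=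
    Real.log_le_sub_one_of_pos (by positivity)
  -- After the tangent bounds an affine function of δ remains. The rational constants in `h4` and
  -- `h5` are those for which it vanishes identically.
  have h4 : (-11 / 42 : ℝ) ≤ Real.log (24 / 31) := by
    rw [Real.le_log_iff_exp_le (by norm_num), show (-11 / 42 : ℝ) = -(11 / 42) by norm_num,
      Real.exp_neg, inv_le_comm₀ (Real.exp_pos _) (by norm_num)]
    refine le_trans ?_ (Real.quadratic_le_exp_of_nonneg (by norm_num))
    norm_num
  have h5 : (10 / 21 : ℝ) ≤ Real.log (252 / 155) := by
    rw [Real.le_log_iff_exp_le (by norm_num)]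
    refine (Real.exp_bound' (n := 4) (by norm_num) (by norm_num) (by norm_num)).trans ?_
    norm_num [Finset.sum_range_succ, Nat.factorial]
  rw [show (24 / 31 : ℝ) = 10 / 31 * 2.4 by norm_num, Real.log_mul (by norm_num) (by norm_num)] at h4
  rw [show (252 / 155 : ℝ) = 21 / 31 * 2.4 by norm_num,
    Real.log_mul (by norm_num) (by norm_num)] at h5
  rw [Real.log_div (by norm_num) (by positivity)] at h1 h2
  rw [Real.log_div hu.ne' (by norm_num)] at h3
  rw [Real.log_div (by norm_num) (by positivity), Real.log_mul (by norm_num) hδ0.ne', Real.log_one,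
    Real.log_div hu.ne' hδ0.ne']
  have h6 := mul_le_mul_of_nonneg_left h1 hδ0.le
  have h7 := mul_le_mul_of_nonneg_left h2 hu.le
  have h8 : δ * (10 / 31 / δ - 1) = 10 / 31 - δ := by field_simp
  have h9 : (1 - δ) * (21 / 31 / (1 - δ) - 1) = 21 / 31 - (1 - δ) := by field_simp
  have h10 := mul_le_mul_of_nonneg_left h4 hδ0.le
  have h11 := mul_le_mul_of_nonneg_left h5 (show (0 : ℝ) ≤ 1 - 2 * δ by linarith)
  rw [h8] at h6
  rw [h9] at h7
  linarith

/-! ### Cheap laws that make an arm win a duel -/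

/-- The mixture dominates (1 - ε) q pointwise. -/
theorem relEntropy_mix_le {p q : Feedback → ℝ} (hp : ∀ x, 0 ≤ p x) (hp1 : ∑ x, p x = 1)
    (hq : ∀ x, 0 ≤ q x) (hac : ∀ x, q x = 0 → p x = 0) {ε : ℝ} (hε : 0 ≤ ε) (hε1 : ε < 1) :
    relEntropy p (fun x => (1 - ε) * q x + if x = .succ then ε else 0) ≤
      relEntropy p q - Real.log (1 - ε) := by
  have h : ∀ x, p x * Real.log (p x / ((1 - ε) * q x + if x = .succ then ε else 0)) ≤
      p x * Real.log (p x / q x) - p x * Real.log (1 - ε) := by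
    intro x
    rcases (hp x).eq_or_lt with h | h
    · simp [← h]
    · have hqx : 0 < q x := lt_of_le_of_ne (hq x) fun h' => h.ne' (hac x h'.symm)
      have h1 : 0 < (1 - ε) * q x := mul_pos (by linarith) hqx
      have h2 : (1 - ε) * q x ≤ (1 - ε) * q x + if x = .succ then ε else 0 := by
        split_ifs <;> linarith
      rw [← mul_sub, Real.log_div h.ne' (h1.trans_le h2).ne', Real.log_div h.ne' hqx.ne']
      refine mul_le_mul_of_nonneg_left ?_ h.le
      have h3 := Real.log_le_log h1 h2
      rw [Real.log_mul (by linarith) hqx.ne'] at h3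
      linarith
  have := Finset.sum_le_sum fun x (_ : x ∈ Finset.univ) => h x
  rw [Finset.sum_sub_distrib, ← Finset.sum_mul, hp1, one_mul] at this
  exact this

/-- A distribution of the feedback that makes the first arm the winner of the duel. -/
structure IsWinningLaw (q : Feedback → ℝ) : Prop where
  nonneg : ∀ x, 0 ≤ q x
  sum_eq_one : ∑ x, q x = 1
  indiff_lt : q .indiff < q .succ
  prec_lt : q .prec < q .succ

theorem isWinningLaw_mix {q : Feedback → ℝ} (hq : ∀ x, 0 ≤ q x) (hq1 : ∑ x, q x = 1)
    (h1 : q .indiff ≤ q .succ) (h2 : q .prec ≤ q .succ) {ε : ℝ} (hε : 0 < ε) (hε1 : ε < 1) :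
    IsWinningLaw fun x => (1 - ε) * q x + if x = .succ then ε else 0 where
  nonneg x := by
    have := mul_nonneg (show 0 ≤ 1 - ε by linarith) (hq x)
    split_ifs <;> linarith
  sum_eq_one := by
    rw [Finset.sum_add_distrib, ← Finset.mul_sum, hq1]
    simp
  indiff_lt := by
    have := mul_le_mul_of_nonneg_left h1 (show 0 ≤ 1 - ε by linarith)
    simpa using by linarith
  prec_lt := by
    have := mul_le_mul_of_nonneg_left h2 (show 0 ≤ 1 - ε by linarith)
    simpa using by linarith

/-- If `succ` is already a most likely outcome, possibly tied, an arbitrarily cheap admixture of the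
point mass at `succ` makes it the strict winner. -/
theorem exists_isWinningLaw_of_tie {p q : Feedback → ℝ} (hp : ∀ x, 0 ≤ p x) (hp1 : ∑ x, p x = 1)
    (hq : ∀ x, 0 ≤ q x) (hq1 : ∑ x, q x = 1) (hac : ∀ x, q x = 0 → p x = 0)
    (h1 : q .indiff ≤ q .succ) (h2 : q .prec ≤ q .succ) {B : ℝ} (hB : relEntropy p q < B) :
    ∃ r, IsWinningLaw r ∧ (∀ x, r x = 0 → q x = 0) ∧ (q .indiff = 0 → r .indiff = 0) ∧
      relEntropy p r ≤ B := by
  set η := B - relEntropy p q with hη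
  have hηpos : 0 < η := by linarith
  -- Chosen so that the cost -log (1 - ε) of the mixture equals the slack η.
  set ε := 1 - Real.exp (-η) with hε
  have he : Real.exp (-η) < 1 := by
    simpa using Real.exp_lt_exp.2 (show -η < 0 by linarith)
  have he0 := Real.exp_pos (-η)
  have hε0 : 0 < ε := by linarith
  have hε1 : ε < 1 := by linarith
  refine ⟨_, isWinningLaw_mix hq hq1 h1 h2 hε0 hε1, fun x hx => ?_, fun h => by simp [h],
    (relEntropy_mix_le hp hp1 hq hac hε0.le hε1).trans ?_⟩
  · have h3 : 0 ≤ (1 - ε) * q x := mul_nonneg (by linarith) (hq x)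
    have h4 : (1 - ε) * q x = 0 := by
      split_ifs at hx <;> linarith
    exact (mul_eq_zero.1 h4).resolve_left (by linarith)
  · rw [show 1 - ε = Real.exp (-η) by rw [hε]; ring, Real.log_exp]
    linarith

/-- The difference 3 (y - 1) / (y + 2) - log y vanishes at 1 and its derivative has the sign of (y -
1)(4 - y). It is applied to three times a probability, whence the range up to 3. -/
theorem add_two_mul_log_le {x : ℝ} (hx0 : 0 < x) (hx : x ≤ 3) :
    (x + 2) * Real.log x ≤ 3 * (x - 1) := by
  have hderiv : ∀ y : ℝ, 0 < y → HasDerivAt (fun y => 3 * (y - 1) / (y + 2) - Real.log y)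
      (9 / (y + 2) ^ 2 - 1 / y) y := by
    intro y hy
    have h1 : HasDerivAt (fun y : ℝ => 3 * (y - 1)) 3 y := by
      simpa using ((hasDerivAt_id y).sub_const 1).const_mul 3
    have h2 : HasDerivAt (fun y : ℝ => y + 2) 1 y := (hasDerivAt_id y).add_const 2
    have h3 := (h1.div h2 (by positivity)).sub (Real.hasDerivAt_log hy.ne')
    refine h3.congr_deriv ?_
    field_simp
    ring
  have hsign : ∀ y : ℝ, 0 < y → 9 / (y + 2) ^ 2 - 1 / y = (y - 1) * (4 - y) / (y * (y + 2) ^ 2) := by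
    intro y hy
    field_simp
    ring
  suffices h : 0 ≤ 3 * (x - 1) / (x + 2) - Real.log x by
    rw [sub_nonneg, le_div_iff₀ (by linarith)] at h
    linarith
  have h0 : (0 : ℝ) = 3 * (1 - 1) / (1 + 2) - Real.log 1 := by simp
  rw [h0]
  rcases le_total x 1 with h | h
  · refine antitoneOn_of_deriv_nonpos (convex_Icc x 1)
      (fun y hy => (hderiv y (hx0.trans_le hy.1)).continuousAt.continuousWithinAt)
      (fun y hy => ?_) (fun y hy => ?_) (Set.left_mem_Icc.2 h) (Set.right_mem_Icc.2 h) h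
    · rw [interior_Icc] at hy
      exact (hderiv y (hx0.trans hy.1)).differentiableAt.differentiableWithinAt
    · rw [interior_Icc] at hy
      have hy0 := hx0.trans hy.1
      rw [(hderiv y hy0).deriv, hsign y hy0]
      exact div_nonpos_of_nonpos_of_nonneg
        (mul_nonpos_of_nonpos_of_nonneg (by linarith [hy.2]) (by linarith [hy.2])) (by positivity)
  · refine monotoneOn_of_deriv_nonneg (convex_Icc 1 x)
      (fun y hy => (hderiv y (by linarith [hy.1])).continuousAt.continuousWithinAt)
      (fun y hy => ?_) (fun y hy => ?_) (Set.left_mem_Icc.2 h) (Set.right_mem_Icc.2 h) h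
    · rw [interior_Icc] at hy
      exact (hderiv y (by linarith [hy.1])).differentiableAt.differentiableWithinAt
    · rw [interior_Icc] at hy
      have hy0 : 0 < y := by linarith [hy.1]
      rw [(hderiv y hy0).deriv, hsign y hy0]
      exact div_nonneg (mul_nonneg (by linarith [hy.1]) (by linarith [hy.2])) (by positivity)

theorem sub_mul_log_sub_log_pos {a b : ℝ} (ha : 0 < a) (hab : a < b) :
    0 < (b - a) * (Real.log b - Real.log a) :=
  mul_pos (by linarith) (by linarith [Real.log_lt_log ha hab])

/-- Three-point entropy bound: the relative entropy with respect to the uniform distribution is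
less than half of the relative entropy with respect to the exchange of the extreme weights. -/
theorem relEntropy_uniform_lt {a b c : ℝ} (ha : 0 < a) (hab : a ≤ b) (hbc : b ≤ c) (hac : a < c)
    (hsum : a + b + c = 1) :
    a * Real.log (a / (1 / 3)) + b * Real.log (b / (1 / 3)) + c * Real.log (c / (1 / 3)) <
      1 / 2 * ((c - a) * (Real.log c - Real.log a)) := by
  have hb : 0 < b := ha.trans_le hab
  have hc : 0 < c := hb.trans_le hbc
  have e : ∀ x : ℝ, 0 < x → Real.log (x / (1 / 3)) = Real.log x + Real.log 3 := by
    intro x hx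
    rw [div_div_eq_mul_div, div_one, Real.log_mul hx.ne' (by norm_num)]
  have g : ∀ x : ℝ, 0 < x → x ≤ 1 →
      (3 * x + 2) * (Real.log x + Real.log 3) ≤ 3 * (3 * x - 1) := by
    intro x hx hx1
    have := add_two_mul_log_le (x := 3 * x) (by linarith) (by linarith)
    rw [Real.log_mul (by norm_num) hx.ne'] at this
    linarith
  rw [e a ha, e b hb, e c hc]
  have g1 := g a ha (by linarith)
  have g2 := g b hb (by linarith)
  have g3 := g c hc (by linarith)
  have m1 := Real.log_le_log ha hab
  have m2 := Real.log_le_log hb hbc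
  have hpos := sub_mul_log_sub_log_pos ha hac
  have k1 : (b - a) * (Real.log b - Real.log a) + (c - b) * (Real.log c - Real.log b) ≤
      (c - a) * (Real.log c - Real.log a) := by
    nlinarith [mul_nonneg (sub_nonneg.2 hab) (sub_nonneg.2 m2),
      mul_nonneg (sub_nonneg.2 hbc) (sub_nonneg.2 m1)]
  have hb' : b = 1 - a - c := by linarith
  set A := Real.log a
  set B := Real.log b
  set C := Real.log c
  set T := Real.log 3
  -- Let S be the relative entropy to the uniform law, R the sum of log (3x) over the three weights,
  -- and J = (c - a)(C - A). Then `g1`, `g2`, `g3` add up to 3S + 2R ≤ 0, while `key` and `k1` give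
  -- 3S - R ≤ 2J. Hence 9S ≤ 4J, and 4/9 < 1/2.
  have key : 3 * (a * A + b * B + c * C) - (A + B + C) =
      (b - a) * (B - A) + (c - b) * (C - B) + (c - a) * (C - A) := by
    subst hb'
    ring
  have hT : a * T + b * T + c * T = T := by rw [← add_mul, ← add_mul, hsum, one_mul]
  nlinarith

/-- By concavity log ((a + c) / 2) exceeds the mean of log a and log c; inserting that mean would
give equality. -/
theorem relEntropy_midpoint_lt {a c : ℝ} (ha : 0 < a) (hac : a < c) :
    a * Real.log (a / ((a + c) / 2)) + c * Real.log (c / ((a + c) / 2)) <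
      1 / 2 * ((c - a) * (Real.log c - Real.log a)) := by
  have hc : 0 < c := ha.trans hac
  have hm : 0 < (a + c) / 2 := by linarith
  rw [Real.log_div ha.ne' hm.ne', Real.log_div hc.ne' hm.ne']
  have h : Real.log a + Real.log c < 2 * Real.log ((a + c) / 2) := by
    rw [two_mul, ← Real.log_mul ha.ne' hc.ne', ← Real.log_mul hm.ne' hm.ne']
    exact Real.log_lt_log (by positivity) (by nlinarith [mul_pos (sub_pos.2 hac) (sub_pos.2 hac)])
  nlinarith [mul_lt_mul_of_pos_left h (show 0 < a + c by linarith)]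

/-- If indifference is the most likely feedback, then some law in favour of the first arm is less
than half as far away as the law with the first two probabilities exchanged. -/
theorem exists_isWinningLaw_of_indiff {p : Feedback → ℝ} (hp : ∀ x, 0 < p x)
    (hp1 : ∑ x, p x = 1) (h1 : p .succ < p .indiff) (h2 : p .prec < p .indiff) :
    ∃ r, IsWinningLaw r ∧ (∀ x, r x = 0 → p x = 0) ∧ relEntropy p r ≤
      1 / 2 * ((p .indiff - p .succ) * (Real.log (p .indiff) - Real.log (p .succ))) := by
  have hsum := hp1
  rw [Feedback.sum_eq] at hsum
  have s0 := hp .succ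
  have i0 := hp .indiff
  have p0 := hp .prec
  suffices h : ∃ q : Feedback → ℝ, (∀ x, 0 < q x) ∧ ∑ x, q x = 1 ∧ q .indiff ≤ q .succ ∧
      q .prec ≤ q .succ ∧ relEntropy p q <
        1 / 2 * ((p .indiff - p .succ) * (Real.log (p .indiff) - Real.log (p .succ))) by
    obtain ⟨q, hq, hq1, hqi, hqp, hB⟩ := h
    obtain ⟨r, hr, hr0, -, hrB⟩ := exists_isWinningLaw_of_tie (fun x => (hp x).le) hp1
      (fun x => (hq x).le) hq1 (fun x hx => absurd hx (hq x).ne') hqi hqp hB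
    exact ⟨r, hr, fun x hx => absurd (hr0 x hx) (hq x).ne', hrB⟩
  -- If `prec` is the least likely outcome, levelling the other two creates the required tie.
  -- Otherwise levelling could leave `prec` ahead, and the uniform law is used.
  rcases le_total (p .prec) (p .succ) with h | h
  · refine ⟨fun x => if x = .prec then p .prec else (p .succ + p .indiff) / 2, fun x => ?_, ?_, ?_,
      ?_, ?_⟩
    · dsimp only
      split_ifs <;> linarith
    · simp [Feedback.sum_eq]
      linarith
    · simp
    · simp
      linarith
    · have := relEntropy_midpoint_lt s0 h1
      simp only [relEntropy, Feedback.sum_eq]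
      simp [div_self p0.ne'] at this ⊢
      linarith
  · refine ⟨fun _ => 1 / 3, fun x => by norm_num, ?_, le_rfl, le_rfl, ?_⟩
    · rw [Feedback.sum_eq]; norm_num
    · have := relEntropy_uniform_lt s0 h h2.le h1 (by linarith)
      simp only [relEntropy, Feedback.sum_eq]
      linarith

/-! ### Averaging over subsets -/

/-- Double counting: each k in L lies in C(|L| - 1, m - 1) of the subsets. -/
theorem sum_powersetCard_sum {α : Type*} [DecidableEq α] (L : Finset α) (m : ℕ) (z : α → ℝ) :
    ∑ S ∈ L.powersetCard m, ∑ k ∈ S, z k =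
      (if 1 ≤ m then ((L.card - 1).choose (m - 1) : ℝ) else 0) * ∑ k ∈ L, z k := by
  rcases m with _ | m
  · simp
  have h1 : ∀ S ∈ L.powersetCard (m + 1), ∑ k ∈ S, z k = ∑ k ∈ L, if k ∈ S then z k else 0 := by
    intro S hS
    rw [← Finset.sum_filter, Finset.filter_mem_eq_inter,
      Finset.inter_eq_right.2 (Finset.mem_powersetCard.1 hS).1]
  rw [Finset.sum_congr rfl h1, Finset.sum_comm, Finset.mul_sum]
  refine Finset.sum_congr rfl fun k hk => ?_
  rw [← Finset.sum_filter, Finset.sum_const, nsmul_eq_mul]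
  congr 1
  simp only [Nat.le_add_left, if_true, Nat.add_sub_cancel]
  norm_cast
  rw [← Finset.card_erase_of_mem hk, ← Finset.card_powersetCard]
  symm
  refine Finset.card_bij' (fun S _ => insert k S) (fun S _ => S.erase k) ?_ ?_ ?_ ?_
  · intro S hS
    obtain ⟨hS, hc⟩ := Finset.mem_powersetCard.1 hS
    have hkS : k ∉ S := fun h => by simpa using hS h
    simp only [Finset.mem_filter, Finset.mem_powersetCard, Finset.mem_insert_self, and_true,
      Finset.card_insert_of_notMem hkS, hc]
    exact Finset.insert_subset hk (hS.trans (Finset.erase_subset _ _))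
  · intro S hS
    simp only [Finset.mem_filter, Finset.mem_powersetCard] at hS ⊢
    refine ⟨Finset.erase_subset_erase _ hS.1.1, ?_⟩
    rw [Finset.card_erase_of_mem hS.2, hS.1.2, Nat.add_sub_cancel]
  · intro S hS
    have hkS : k ∉ S := fun h => by simpa using (Finset.mem_powersetCard.1 hS).1 h
    exact Finset.erase_insert hkS
  · intro S hS
    exact Finset.insert_erase (Finset.mem_filter.1 hS).2

/-- Averaging a lower bound over all pairs of subsets of prescribed cardinalities. -/
theorem choose_mul_choose_mul_le {α : Type*} [DecidableEq α] (I L : Finset α) (i l : ℕ)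
    (z : α → ℝ) (c : ℝ)
    (h : ∀ S ∈ I.powersetCard i, ∀ T ∈ L.powersetCard l, c ≤ ∑ k ∈ S, z k + ∑ k ∈ T, z k) :
    (I.card.choose i * L.card.choose l : ℝ) * c ≤
      (if 1 ≤ i then ((I.card - 1).choose (i - 1) : ℝ) * L.card.choose l else 0) * ∑ k ∈ I, z k +
      (if 1 ≤ l then (I.card.choose i : ℝ) * (L.card - 1).choose (l - 1) else 0) *
        ∑ k ∈ L, z k := by
  have h1 := Finset.sum_le_sum fun S hS => Finset.sum_le_sum fun T hT => h S hS T hT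
  simp only [Finset.sum_add_distrib, Finset.sum_const, Finset.card_powersetCard, nsmul_eq_mul] at h1
  rw [← Finset.mul_sum, sum_powersetCard_sum, sum_powersetCard_sum] at h1
  calc _ = (I.card.choose i : ℝ) * (L.card.choose l * c) := by ring
    _ ≤ _ := h1
    _ = _ := by split_ifs <;> ring

/-! ### Copeland scores and the replacement of a row -/

namespace Feedback

/-- Exchange of the two arms of a duel. -/
def swap : Feedback → Feedback
  | succ => prec
  | indiff => indiff
  | prec => succ

/-- The contribution of a duel with feedback law `f` to the Copeland score of its first arm. -/
noncomputable def value (f : Feedback → ℝ) : ℝ :=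
  (if max (f prec) (f indiff) < f succ then 1 else 0) +
    1 / 2 * if max (f succ) (f prec) < f indiff then 1 else 0

theorem value_nonneg (f : Feedback → ℝ) : 0 ≤ value f := by
  unfold value; positivity

theorem value_add_value_swap_le (f : Feedback → ℝ) : value f + value (f ∘ swap) ≤ 1 := by
  simp only [value, Function.comp_apply, swap, max_lt_iff]
  split_ifs <;> first | (exfalso; linarith) | norm_num

theorem value_eq_one {f : Feedback → ℝ} (h1 : f indiff < f succ) (h2 : f prec < f succ) :
    value f = 1 := by
  rw [value, if_pos (max_lt h2 h1), if_neg (by rw [max_lt_iff]; intro h; linarith [h.1])]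
  norm_num

theorem value_swap_eq_zero {f : Feedback → ℝ} (h1 : f indiff < f succ) (h2 : f prec < f succ) :
    value (f ∘ swap) = 0 := by
  have := value_add_value_swap_le f
  rw [value_eq_one h1 h2] at this
  exact le_antisymm (by linarith) (value_nonneg _)

theorem value_eq_half {f : Feedback → ℝ} (h1 : f succ < f indiff) (h2 : f prec < f indiff) :
    value f = 1 / 2 := by
  rw [value, if_pos (max_lt h1 h2), if_neg (by rw [max_lt_iff]; intro h; linarith [h.2])]
  norm_num

theorem sum_swap {M : Type*} [AddCommMonoid M] (f : Feedback → M) :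
    ∑ x, f (swap x) = ∑ x, f x := by
  rw [sum_eq, sum_eq, swap, swap, swap, add_comm (f prec + _), add_comm (f prec), add_assoc]

theorem relEntropy_swap (p q : Feedback → ℝ) :
    relEntropy (p ∘ swap) (q ∘ swap) = relEntropy p q :=
  sum_swap fun x => p x * Real.log (p x / q x)

end Feedback

namespace DuelingProblem

open Feedback

variable {n : ℕ} (P : DuelingProblem n)

theorem prob_swap (i j : Fin n) : P.prob j i = P.prob i j ∘ swap := by
  funext x
  cases x
  · exact P.pSucc_swap i j
  · have h1 := P.sum_eq_one i j
    have h2 := P.sum_eq_one j i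
    have h3 := P.pSucc_swap i j
    have h4 := P.pSucc_swap j i
    simp only [prob, Function.comp_apply, swap]
    linarith
  · exact (P.pSucc_swap j i).symm

theorem copelandScore_eq (i : Fin n) :
    P.copelandScore i = ∑ k ∈ Finset.univ.erase i, value (P.prob i k) := by
  simp only [copelandScore, value, Finset.sum_add_distrib, ← Finset.mul_sum, prob]
  congr!

theorem copelandScore_le (i : Fin n) : P.copelandScore i ≤ ⨆ k, P.copelandScore k :=
  le_ciSup (Set.finite_range _).bddAbove i

theorem mem_superior {j k : Fin n} : k ∈ P.superior j ↔
    k ≠ j ∧ P.prob j k .indiff < P.prob j k .prec ∧ P.prob j k .succ < P.prob j k .prec := by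
  rw [P.prob_swap k j]
  simp only [superior, Finset.mem_filter, Finset.mem_univ, true_and, max_lt_iff, prob,
    Function.comp_apply, swap]
  tauto

theorem mem_indifferent {j k : Fin n} : k ∈ P.indifferent j ↔
    k ≠ j ∧ P.prob j k .succ < P.prob j k .indiff ∧ P.prob j k .prec < P.prob j k .indiff := by
  rw [P.prob_swap k j]
  simp only [indifferent, Finset.mem_filter, Finset.mem_univ, true_and, max_lt_iff, prob,
    Function.comp_apply, swap]

theorem disjoint_indifferent_superior (j : Fin n) :
    Disjoint (P.indifferent j) (P.superior j) := by
  rw [Finset.disjoint_left]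
  intro k h1 h2
  have := (P.mem_indifferent.1 h1).2.2
  have := (P.mem_superior.1 h2).2.1
  linarith

/-- The problem in which the laws of the duels of the arm `j` are replaced by `q`. -/
def withRow (j : Fin n) (q : Fin n → Feedback → ℝ) (hq : ∀ k x, 0 ≤ q k x)
    (hq1 : ∀ k, ∑ x, q k x = 1) : DuelingProblem n where
  -- The diagonal is kept, since `q j` need not be invariant under `swap`.
  pSucc a b := if a = b then P.pSucc a b else if a = j then q b .succ else
    if b = j then q a .prec else P.pSucc a b
  pIndiff a b := if a = b then P.pIndiff a b else if a = j then q b .indiff else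
    if b = j then q a .indiff else P.pIndiff a b
  pPrec a b := if a = b then P.pPrec a b else if a = j then q b .prec else
    if b = j then q a .succ else P.pPrec a b
  pSucc_nonneg a b := by split_ifs <;> first | exact hq _ _ | exact P.pSucc_nonneg _ _
  pIndiff_nonneg a b := by split_ifs <;> first | exact hq _ _ | exact P.pIndiff_nonneg _ _
  pPrec_nonneg a b := by split_ifs <;> first | exact hq _ _ | exact P.pPrec_nonneg _ _
  sum_eq_one a b := by
    have h1 := P.sum_eq_one a b
    have h2 := hq1 a
    have h3 := hq1 b
    rw [sum_eq] at h2 h3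
    split_ifs <;> linarith
  pSucc_swap a b := by
    have h := P.pSucc_swap a b
    by_cases hab : a = b
    · subst hab
      simpa using h
    · by_cases ha : a = j
      · have hb : b ≠ j := fun hb => hab (ha.trans hb.symm)
        simp [ha, hb, hb.symm]
      · by_cases hb : b = j <;> simp [hab, Ne.symm hab, ha, hb, Ne.symm ha, h]

section withRow

variable {P} {j : Fin n} {q : Fin n → Feedback → ℝ} {hq : ∀ k x, 0 ≤ q k x}
  {hq1 : ∀ k, ∑ x, q k x = 1}

theorem withRow_prob_self {k : Fin n} (hk : k ≠ j) : (P.withRow j q hq hq1).prob j k = q k := by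
  funext x
  cases x <;> simp [prob, withRow, hk.symm]

theorem withRow_prob_right {k : Fin n} (hk : k ≠ j) :
    (P.withRow j q hq hq1).prob k j = q k ∘ swap := by
  rw [prob_swap _ j k, withRow_prob_self hk]

theorem withRow_prob_diag (a : Fin n) : (P.withRow j q hq hq1).prob a a = P.prob a a := by
  funext x
  cases x <;> simp [prob, withRow]

theorem withRow_prob_of_ne {a b : Fin n} (ha : a ≠ j) (hb : b ≠ j) :
    (P.withRow j q hq hq1).prob a b = P.prob a b := by
  funext x
  cases x <;> simp [prob, withRow, ha, hb]

theorem withRow_copelandScore_self :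
    (P.withRow j q hq hq1).copelandScore j = ∑ k ∈ Finset.univ.erase j, value (q k) := by
  rw [copelandScore_eq]
  exact Finset.sum_congr rfl fun k hk => by rw [withRow_prob_self (Finset.ne_of_mem_erase hk)]

theorem withRow_copelandScore_of_ne {i : Fin n} (hi : i ≠ j) :
    (P.withRow j q hq hq1).copelandScore i =
      P.copelandScore i - value (P.prob i j) + value (q i ∘ swap) := by
  have hj : j ∈ Finset.univ.erase i := Finset.mem_erase.2 ⟨hi.symm, Finset.mem_univ j⟩
  rw [copelandScore_eq, copelandScore_eq, ← Finset.add_sum_erase _ _ hj,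
    ← Finset.add_sum_erase _ _ hj, withRow_prob_right hi]
  have : ∀ k ∈ (Finset.univ.erase i).erase j, value ((P.withRow j q hq hq1).prob i k) =
      value (P.prob i k) := fun k hk => by rw [withRow_prob_of_ne hi (Finset.ne_of_mem_erase hk)]
  rw [Finset.sum_congr rfl this]
  ring

/-- Only duels involving `j` change, and relative entropy is invariant under `swap`, so both orders
of a pair have the same cost. -/
theorem withRow_sum_relEntropy (e : Fin n × Fin n → ℝ) :
    ∑ d, relEntropy (P.prob d.1 d.2) ((P.withRow j q hq hq1).prob d.1 d.2) * e d =
      ∑ k ∈ Finset.univ.erase j, relEntropy (P.prob j k) (q k) * (e (j, k) + e (k, j)) := by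
  set Q := P.withRow j q hq hq1
  have h : ∀ a b, relEntropy (P.prob a b) (Q.prob a b) * e (a, b) =
      (if a = j then if b ∈ Finset.univ.erase j then relEntropy (P.prob j b) (q b) * e (j, b) else 0
        else 0) +
      (if b = j then if a ∈ Finset.univ.erase j then relEntropy (P.prob j a) (q a) * e (a, j) else 0
        else 0) := by
    intro a b
    by_cases ha : a = j <;> by_cases hb : b = j
    · subst ha hb
      simp [Q, withRow_prob_diag, relEntropy_self]
    · subst ha
      simp [Q, hb, withRow_prob_self hb]
    · subst hb
      simp only [Q, withRow_prob_right ha, P.prob_swap b a, relEntropy_swap]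
      simp [ha]
    · simp [Q, ha, hb, withRow_prob_of_ne ha hb, relEntropy_self]
  simp only [Fintype.sum_prod_type, h, Finset.sum_add_distrib, mul_add]
  congr 1
  · rw [Finset.sum_comm]
    simp only [Finset.sum_ite_eq', Finset.mem_univ, if_true]
    rw [← Finset.sum_filter, Finset.filter_mem_eq_inter, Finset.univ_inter]
  · simp only [Finset.sum_ite_eq', Finset.mem_univ, if_true]
    rw [← Finset.sum_filter, Finset.filter_mem_eq_inter, Finset.univ_inter]

theorem withRow_noIndifferences (hP : P.NoIndifferences) (h : ∀ k ≠ j, q k .indiff = 0) :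
    (P.withRow j q hq hq1).NoIndifferences := by
  intro a b
  by_cases hab : a = b
  · simp [withRow, hab, hP b b]
  · by_cases ha : a = j
    · have hb : b ≠ j := fun hb => hab (ha.trans hb.symm)
      simp [withRow, ha, hb.symm, h b hb]
    · by_cases hb : b = j
      · simp [withRow, ha, hb, h a ha]
      · simp [withRow, ha, hb, hP a b]

end withRow

theorem not_mem_copelandSet {i k : Fin n} (h : P.copelandScore i < P.copelandScore k) :
    i ∉ P.copelandSet := fun hi =>
  absurd (P.copelandScore_le k) (by rw [← show _ = ⨆ j, P.copelandScore j from hi]; exact not_le.2 h)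

/-! ### Deposing the winner -/

/-- Every row of the arm `j` that keeps the problem in the class `S` and deposes `w` satisfies the
information bound with constant `c` and numbers of duels `N`. -/
def RowBound (S : Set (DuelingProblem n)) (w j : Fin n) (c : ℝ) (N : Fin n → ℝ) : Prop :=
  ∀ q hq hq1, (∀ k ≠ j, ∀ x, q k x = 0 → P.prob j k x = 0) → P.withRow j q hq hq1 ∈ S →
    w ∉ (P.withRow j q hq hq1).copelandSet →
    c ≤ ∑ k ∈ Finset.univ.erase j, relEntropy (P.prob j k) (q k) * N k

variable {P}

/-- Winning against all of `T` lifts `j` by more than its gap, while the score of `w` cannot rise.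
Other arms are irrelevant: `j` overtaking `w` already deposes it. -/
theorem RowBound.le_sum {S : Set (DuelingProblem n)} {w j : Fin n} {c : ℝ} {N : Fin n → ℝ}
    (h : P.RowBound S w j c N) (hw : P.copelandSet = {w}) (hj : j ≠ w) (T : Finset (Fin n))
    (hT : j ∉ T) {r : Fin n → Feedback → ℝ} (hr : ∀ k ∈ T, IsWinningLaw (r k))
    (hac : ∀ k ∈ T, ∀ x, r k x = 0 → P.prob j k x = 0)
    (hgap : P.gap j < ∑ k ∈ T, (1 - value (P.prob j k)))
    (hS : ∀ q hq hq1, (∀ k, q k = r k ∧ k ∈ T ∨ q k = P.prob j k) → P.withRow j q hq hq1 ∈ S) :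
    c ≤ ∑ k ∈ T, relEntropy (P.prob j k) (r k) * N k := by
  set q : Fin n → Feedback → ℝ := fun k => if k ∈ T then r k else P.prob j k with hqdef
  have hqT : ∀ k ∈ T, q k = r k := fun k hk => if_pos hk
  have hqT' : ∀ k, k ∉ T → q k = P.prob j k := fun k hk => if_neg hk
  have hq : ∀ k x, 0 ≤ q k x := by
    intro k x
    by_cases hk : k ∈ T
    · rw [hqT k hk]; exact (hr k hk).nonneg x
    · rw [hqT' k hk]; exact P.prob_nonneg j k x
  have hq1 : ∀ k, ∑ x, q k x = 1 := by
    intro k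
    by_cases hk : k ∈ T
    · rw [hqT k hk]; exact (hr k hk).sum_eq_one
    · rw [hqT' k hk]; exact P.sum_prob j k
  have hTsub : T ⊆ Finset.univ.erase j := fun k hk =>
    Finset.mem_erase.2 ⟨fun hkj => hT (hkj ▸ hk), Finset.mem_univ k⟩
  have hsplit : ∀ f : Fin n → ℝ, (∀ k, k ∉ T → f k = 0) →
      ∑ k ∈ Finset.univ.erase j, f k = ∑ k ∈ T, f k := fun f hf =>
    (Finset.sum_subset hTsub fun k _ hk => hf k hk).symm
  have hsup : ⨆ i, P.copelandScore i = P.copelandScore w := by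
    have : w ∈ P.copelandSet := by rw [hw]; rfl
    exact this.symm
  have hwin : (P.withRow j q hq hq1).copelandScore w < (P.withRow j q hq hq1).copelandScore j := by
    have h1 : (P.withRow j q hq hq1).copelandScore w ≤ P.copelandScore w := by
      rw [withRow_copelandScore_of_ne hj.symm]
      by_cases hwT : w ∈ T
      · rw [hqT w hwT, value_swap_eq_zero (hr w hwT).indiff_lt (hr w hwT).prec_lt]
        linarith [value_nonneg (P.prob w j)]
      · rw [hqT' w hwT, ← P.prob_swap]
        linarith
    have h2 : (P.withRow j q hq hq1).copelandScore j - P.copelandScore j =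
        ∑ k ∈ T, (1 - value (P.prob j k)) := by
      rw [withRow_copelandScore_self, copelandScore_eq, ← Finset.sum_sub_distrib,
        hsplit _ fun k hk => by rw [hqT' k hk, sub_self]]
      refine Finset.sum_congr rfl fun k hk => ?_
      rw [hqT k hk, value_eq_one (hr k hk).indiff_lt (hr k hk).prec_lt]
    unfold gap at hgap
    rw [hsup] at hgap
    linarith
  have hmain := h q hq hq1 (fun k _ x hx => by
      by_cases hk : k ∈ T
      · rw [hqT k hk] at hx; exact hac k hk x hx
      · rwa [hqT' k hk] at hx)
    (hS q hq hq1 fun k => by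
      by_cases hk : k ∈ T
      · exact Or.inl ⟨hqT k hk, hk⟩
      · exact Or.inr (hqT' k hk)) (not_mem_copelandSet _ hwin)
  rw [hsplit _ fun k hk => by rw [hqT' k hk, relEntropy_self, zero_mul]] at hmain
  refine hmain.trans (le_of_eq (Finset.sum_congr rfl fun k hk => by rw [hqT k hk]))

/-- An arm that wins every duel has score n - 1; `w`, losing to it, has at most n - 2. -/
theorem RowBound.le_sum_erase {S : Set (DuelingProblem n)} {w j : Fin n} {c : ℝ} {N : Fin n → ℝ}
    (h : P.RowBound S w j c N) (hj : j ≠ w) {r : Fin n → Feedback → ℝ}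
    (hr : ∀ k ≠ j, IsWinningLaw (r k)) (hac : ∀ k ≠ j, ∀ x, r k x = 0 → P.prob j k x = 0)
    (hS : ∀ q hq hq1, (∀ k ≠ j, q k = r k) → P.withRow j q hq hq1 ∈ S) :
    c ≤ ∑ k ∈ Finset.univ.erase j, relEntropy (P.prob j k) (r k) * N k := by
  set q : Fin n → Feedback → ℝ := fun k => if k = j then P.prob j k else r k with hqdef
  have hqj : ∀ k ≠ j, q k = r k := fun k hk => if_neg hk
  have hq : ∀ k x, 0 ≤ q k x := by
    intro k x
    by_cases hk : k = j
    · simp only [hqdef, if_pos hk]; exact P.prob_nonneg j k x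
    · rw [hqj k hk]; exact (hr k hk).nonneg x
  have hq1 : ∀ k, ∑ x, q k x = 1 := by
    intro k
    by_cases hk : k = j
    · simp only [hqdef, if_pos hk]; exact P.sum_prob j k
    · rw [hqj k hk]; exact (hr k hk).sum_eq_one
  have hwin : (P.withRow j q hq hq1).copelandScore w < (P.withRow j q hq hq1).copelandScore j := by
    have h1 : (P.withRow j q hq hq1).copelandScore j =
        ((Finset.univ.erase j).card : ℝ) := by
      rw [withRow_copelandScore_self, Finset.card_eq_sum_ones, Nat.cast_sum]
      refine Finset.sum_congr rfl fun k hk => ?_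
      have hk' := Finset.ne_of_mem_erase hk
      rw [hqj k hk', value_eq_one (hr k hk').indiff_lt (hr k hk').prec_lt, Nat.cast_one]
    have hjw : j ∈ Finset.univ.erase w := Finset.mem_erase.2 ⟨hj, Finset.mem_univ j⟩
    have h2 : (P.withRow j q hq hq1).copelandScore w ≤
        (((Finset.univ.erase w).erase j).card : ℝ) := by
      rw [copelandScore_eq, ← Finset.add_sum_erase _ _ hjw, withRow_prob_right hj.symm,
        hqj w hj.symm, value_swap_eq_zero (hr w hj.symm).indiff_lt (hr w hj.symm).prec_lt, zero_add,
        Finset.card_eq_sum_ones, Nat.cast_sum]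
      refine Finset.sum_le_sum fun k _ => ?_
      have := value_add_value_swap_le ((P.withRow j q hq hq1).prob w k)
      have := value_nonneg ((P.withRow j q hq hq1).prob w k ∘ swap)
      rw [Nat.cast_one]
      linarith
    have h3 : ((Finset.univ.erase w).erase j).card < (Finset.univ.erase j).card := by
      rw [Finset.card_erase_of_mem (Finset.mem_univ j),
        ← Finset.card_erase_of_mem (Finset.mem_univ w)]
      exact Finset.card_erase_lt_of_mem hjw
    rw [h1]
    exact h2.trans_lt (by exact_mod_cast h3)
  have hmain := h q hq hq1 (fun k hk x hx => by rw [hqj k hk] at hx; exact hac k hk x hx)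
    (hS q hq hq1 hqj) (not_mem_copelandSet _ hwin)
  refine hmain.trans (le_of_eq (Finset.sum_congr rfl fun k hk => ?_))
  rw [hqj k (Finset.ne_of_mem_erase hk)]

theorem isWinningLaw_of_mem_superior {j k : Fin n} (hk : k ∈ P.superior j) :
    IsWinningLaw (P.prob k j) := by
  obtain ⟨-, h1, h2⟩ := P.mem_superior.1 hk
  refine ⟨P.prob_nonneg k j, P.sum_prob k j, ?_, ?_⟩
  · rw [P.prob_swap j k]; exact h1
  · rw [P.prob_swap j k]; exact h2

theorem value_of_mem_superior {j k : Fin n} (hk : k ∈ P.superior j) :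
    value (P.prob j k) = 0 ∧ value (P.prob k j) = 1 := by
  have h := isWinningLaw_of_mem_superior hk
  rw [P.prob_swap k j]
  exact ⟨value_swap_eq_zero h.indiff_lt h.prec_lt, value_eq_one h.indiff_lt h.prec_lt⟩

theorem value_of_mem_indifferent {j k : Fin n} (hk : k ∈ P.indifferent j) :
    value (P.prob j k) = 1 / 2 ∧ value (P.prob k j) = 1 / 2 := by
  obtain ⟨-, h1, h2⟩ := P.mem_indifferent.1 hk
  refine ⟨value_eq_half h1 h2, ?_⟩
  rw [P.prob_swap j k]
  exact value_eq_half h2 h1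

theorem gap_pos {w j : Fin n} (hw : P.copelandSet = {w}) (hj : j ≠ w) : 0 < P.gap j := by
  refine lt_of_le_of_ne (sub_nonneg.2 (P.copelandScore_le j)) fun h => hj ?_
  have : j ∈ P.copelandSet := by
    unfold gap at h
    exact (sub_eq_zero.1 h.symm).symm
  rwa [hw] at this

end DuelingProblem

/-! ### Divergences with values in the extended reals -/

theorem categoricalKL_ne_top {K : ℕ} {p q : Fin K → ℝ} (h : categoricalKL p q ≠ ⊤) :
    ∀ i, q i = 0 → p i = 0 := by
  by_contra h'
  exact h (if_neg h')

theorem le_toReal_categoricalKL {K : ℕ} {p q : Fin K → ℝ} (h : categoricalKL p q ≠ ⊤) :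
    ∑ i, p i * Real.log (p i / q i) ≤ (categoricalKL p q).toReal := by
  rw [categoricalKL, if_pos (categoricalKL_ne_top h)]
  rw [ENNReal.toReal_ofReal']
  exact le_max_left _ _

/-- An infinite divergence makes the infimum 0. If the infimum is ⊤, as for empty `U`, all
divergences vanish, so c ≤ 0 and the product is 0 · ⊤ = 0. -/
theorem ofReal_mul_iInf_inv_le {α : Type*} (U : Finset α) (D : α → ℝ≥0∞) (a : α → ℝ)
    (ha : ∀ k ∈ U, 0 ≤ a k) {c : ℝ}
    (h : (∀ k ∈ U, D k ≠ ⊤) → c ≤ ∑ k ∈ U, a k * (D k).toReal) :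
    ENNReal.ofReal c * ⨅ k ∈ U, (D k)⁻¹ ≤ ENNReal.ofReal (∑ k ∈ U, a k) := by
  set m := ⨅ k ∈ U, (D k)⁻¹ with hm
  have hmle : ∀ k ∈ U, m ≤ (D k)⁻¹ := fun k hk => iInf₂_le k hk
  by_cases hm0 : m = 0
  · simp [hm0]
  have hD : ∀ k ∈ U, D k ≠ ⊤ := by
    intro k hk hk'
    have := hmle k hk
    rw [hk', ENNReal.inv_top] at this
    exact hm0 (le_antisymm this zero_le)
  have hc := h hD
  by_cases hmt : m = ⊤
  · have : c ≤ 0 := by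
      refine hc.trans (le_of_eq (Finset.sum_eq_zero fun k hk => ?_))
      have h1 := hmle k hk
      rw [hmt, top_le_iff, ENNReal.inv_eq_top] at h1
      simp [h1]
    simp [ENNReal.ofReal_of_nonpos this]
  · have hmr : 0 ≤ m.toReal := ENNReal.toReal_nonneg
    rw [← ENNReal.ofReal_toReal hmt, ← ENNReal.ofReal_mul' hmr]
    refine ENNReal.ofReal_le_ofReal ((mul_le_mul_of_nonneg_right hc hmr).trans ?_)
    rw [Finset.sum_mul]
    refine Finset.sum_le_sum fun k hk => ?_
    have h1 : (D k).toReal * m.toReal ≤ 1 := by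
      rw [← ENNReal.toReal_mul]
      refine ENNReal.toReal_le_of_le_ofReal zero_le_one ?_
      rw [ENNReal.ofReal_one]
      calc D k * m ≤ D k * (D k)⁻¹ := mul_le_mul_right (hmle k hk) _
        _ ≤ 1 := ENNReal.mul_inv_le_one _
    rw [mul_assoc]
    exact mul_le_of_le_one_right (ha k hk) h1

/-! ### The bound for a single arm -/

namespace DuelingProblem

open Feedback

variable {n : ℕ} {P : DuelingProblem n}

theorem NoIndifferences.indifferent_eq_empty (hP : P.NoIndifferences) (j : Fin n) :
    P.indifferent j = ∅ := by
  refine Finset.eq_empty_of_forall_notMem fun k hk => ?_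
  have h1 := (P.mem_indifferent.1 hk).2.1
  have h2 := P.prob_nonneg j k .succ
  have h3 : P.prob j k .indiff = 0 := hP j k
  linarith

theorem NoIndifferences.value_eq (hP : P.NoIndifferences) (i k : Fin n) :
    value (P.prob i k) = if max (P.pPrec i k) (P.pIndiff i k) < P.pSucc i k then 1 else 0 := by
  have h : ¬ max (P.pSucc i k) (P.pPrec i k) < P.pIndiff i k := by
    rw [hP i k, max_lt_iff]
    intro h
    linarith [P.pSucc_nonneg i k, h.1]
  simp [value, prob, h]

theorem NoIndifferences.exists_gap_eq (hP : P.NoIndifferences) {w : Fin n}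
    (hw : P.copelandSet = {w}) (j : Fin n) : ∃ m : ℕ, P.gap j = m := by
  have hnat : ∀ i, ∃ a : ℕ, P.copelandScore i = a := by
    intro i
    refine ⟨∑ k ∈ Finset.univ.erase i,
      if max (P.pPrec i k) (P.pIndiff i k) < P.pSucc i k then 1 else 0, ?_⟩
    rw [copelandScore_eq]
    push_cast
    exact Finset.sum_congr rfl fun k _ => hP.value_eq i k
  have hsup : P.copelandScore w = ⨆ i, P.copelandScore i := by
    have : w ∈ P.copelandSet := by rw [hw]; rfl
    exact this
  obtain ⟨a, ha⟩ := hnat w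
  obtain ⟨b, hb⟩ := hnat j
  have hle := P.copelandScore_le j
  rw [← hsup, ha, hb, Nat.cast_le] at hle
  exact ⟨a - b, by rw [gap, ← hsup, ha, hb, Nat.cast_sub hle]⟩

/-- Without indifferences, `P.prob k j` is the law of the duel (j, k) with p and 1 - p exchanged. -/
theorem NoIndifferences.of_divNoIndiff_ne_top (hP : P.NoIndifferences) {j k : Fin n}
    (h : P.divNoIndiff j k ≠ ⊤) :
    (∀ x, P.prob k j x = 0 → P.prob j k x = 0) ∧
      relEntropy (P.prob j k) (P.prob k j) ≤ (P.divNoIndiff j k).toReal := by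
  have hp : P.pPrec j k = 1 - P.pSucc j k := by
    linarith [P.sum_eq_one j k, hP j k]
  have h1 := categoricalKL_ne_top h
  have h2 := le_toReal_categoricalKL h
  rw [P.prob_swap j k]
  constructor
  · intro x hx
    cases x
    · have := h1 0
      simp only [Function.comp_apply, swap, prob, hp] at hx
      simpa [hx, prob] using this
    · exact hx
    · have := h1 1
      simp only [Function.comp_apply, swap, prob] at hx
      simp [hx] at this
  · refine le_trans (le_of_eq ?_) h2
    simp [relEntropy, Feedback.sum_eq, prob, swap, hp, hP j k]

theorem NoIndifferences.coeffNoIndiff_mul_le (hP : P.NoIndifferences) {w j : Fin n} {c : ℝ}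
    (hc : 0 ≤ c) {N : Fin n → ℝ} (hN : ∀ k, 0 ≤ N k)
    (h : P.RowBound {Q | Q.NoIndifferences} w j c N) (hw : P.copelandSet = {w}) (hj : j ≠ w)
    (hD : ∀ k ∈ P.superior j, P.divNoIndiff j k ≠ ⊤) :
    c * P.coeffNoIndiff w j ≤ ∑ k ∈ P.superior j, N k * (P.divNoIndiff j k).toReal := by
  set X := ∑ k ∈ P.superior j, N k * (P.divNoIndiff j k).toReal with hX
  have hX0 : 0 ≤ X := Finset.sum_nonneg fun k _ => mul_nonneg (hN k) ENNReal.toReal_nonneg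
  have hjL : j ∉ P.superior j := fun hjj => (P.mem_superior.1 hjj).1 rfl
  obtain ⟨d, hd⟩ := hP.exists_gap_eq hw j
  have hflip : ∀ k ∈ P.superior j, relEntropy (P.prob j k) (P.prob k j) * N k ≤
      N k * (P.divNoIndiff j k).toReal := fun k hk => by
    rw [mul_comm]
    exact mul_le_mul_of_nonneg_left (hP.of_divNoIndiff_ne_top (hD k hk)).2 (hN k)
  have hfirst : c * (if P.gap j + 1 ≤ ((P.superior j).card : ℝ) then
      ((P.superior j).card : ℝ) / (P.gap j + 1) else 0) ≤ X := by
    split_ifs with hcard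
    · have hbound : ∀ T ∈ (P.superior j).powersetCard (d + 1),
          c ≤ ∑ k ∈ T, N k * (P.divNoIndiff j k).toReal := by
        intro T hT
        obtain ⟨hTL, hTc⟩ := Finset.mem_powersetCard.1 hT
        refine (h.le_sum hw hj T (fun hjT => hjL (hTL hjT)) (r := fun k => P.prob k j)
          (fun k hk => isWinningLaw_of_mem_superior (hTL hk))
          (fun k hk => (hP.of_divNoIndiff_ne_top (hD k (hTL hk))).1) ?_ ?_).trans
          (Finset.sum_le_sum fun k hk => hflip k (hTL hk))
        · rw [Finset.sum_congr rfl fun k hk => by rw [(value_of_mem_superior (hTL hk)).1, sub_zero]]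
          rw [Finset.sum_const, hTc, hd]
          simp
        · intro q hq hq1 hq'
          refine withRow_noIndifferences hP fun k _ => ?_
          rcases hq' k with ⟨h1, -⟩ | h1 <;> rw [h1]
          exacts [hP k j, hP j k]
      have havg := choose_mul_choose_mul_le ∅ (P.superior j) 0 (d + 1)
        (fun k => N k * (P.divNoIndiff j k).toReal) c
        (fun S hS T hT => by
          rw [Finset.powersetCard_zero, Finset.mem_singleton] at hS
          rw [hS, Finset.sum_empty, zero_add]
          exact hbound T hT)
      simp only [Finset.card_empty, Nat.choose_self, Nat.cast_one, one_mul, Finset.sum_empty,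
        mul_zero, zero_add, Nat.le_add_left, if_true, Nat.add_sub_cancel] at havg
      rw [hd] at hcard ⊢
      have hcard' : d + 1 ≤ (P.superior j).card := by exact_mod_cast hcard
      -- This identity turns the averaged factor C(|L|, d + 1) / C(|L| - 1, d) into |L| / (d + 1).
      have hid : (P.superior j).card * ((P.superior j).card - 1).choose d =
          (P.superior j).card.choose (d + 1) * (d + 1) := by
        have := Nat.add_one_mul_choose_eq ((P.superior j).card - 1) d
        rwa [Nat.sub_add_cancel (by omega)] at this
      have hid' : ((P.superior j).card : ℝ) * (((P.superior j).card - 1).choose d : ℝ) =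
          ((P.superior j).card.choose (d + 1) : ℝ) * (d + 1) := by exact_mod_cast hid
      have hpos : (0 : ℝ) < ((P.superior j).card - 1).choose d := by
        exact_mod_cast Nat.choose_pos (by omega)
      rw [mul_div_assoc', div_le_iff₀ (by positivity)]
      refine le_of_mul_le_mul_right ?_ hpos
      calc c * (P.superior j).card * (((P.superior j).card - 1).choose d : ℝ)
          = ((P.superior j).card.choose (d + 1) : ℝ) * c * (d + 1) := by
            rw [mul_assoc, hid']; ring
        _ ≤ (((P.superior j).card - 1).choose d : ℝ) * X * (d + 1) :=
            mul_le_mul_of_nonneg_right havg (by positivity)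
        _ = _ := by ring
    · simpa using hX0
  -- Here `j` is made to win all its duels. Outside `P.superior j` it already wins or ties, so each
  -- of these laws costs at most η, and ε is let go to 0.
  have hall : c ≤ X := by
    refine le_of_forall_pos_le_add fun ε hε => ?_
    set η := ε / (1 + ∑ k, N k) with hη
    have hNsum : 0 ≤ ∑ k, N k := Finset.sum_nonneg fun k _ => hN k
    have hη0 : 0 < η := by positivity
    have hex : ∀ k, ∃ r, k ≠ j → IsWinningLaw r ∧ (∀ x, r x = 0 → P.prob j k x = 0) ∧
        r .indiff = 0 ∧ relEntropy (P.prob j k) r ≤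
          if k ∈ P.superior j then (P.divNoIndiff j k).toReal else η := by
      intro k
      by_cases hkj : k = j
      · exact ⟨P.prob j k, fun h' => absurd hkj h'⟩
      by_cases hk : k ∈ P.superior j
      · obtain ⟨h1, h2⟩ := hP.of_divNoIndiff_ne_top (hD k hk)
        exact ⟨P.prob k j, fun _ => ⟨isWinningLaw_of_mem_superior hk, h1, hP k j, by simpa [hk]⟩⟩
      · have hi : P.prob j k .indiff = 0 := hP j k
        have hsum := P.sum_prob j k
        rw [Feedback.sum_eq] at hsum
        have hs := P.prob_nonneg j k .succ
        have hp := P.prob_nonneg j k .prec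
        have hle : P.prob j k .prec ≤ P.prob j k .succ := by
          by_contra! hlt
          exact hk (P.mem_superior.2 ⟨hkj, by linarith, hlt⟩)
        obtain ⟨r, hr, hr0, hri, hrη⟩ := exists_isWinningLaw_of_tie (P.prob_nonneg j k)
          (P.sum_prob j k) (P.prob_nonneg j k) (P.sum_prob j k) (fun _ => id) (by linarith) hle
          (B := η) (by rw [relEntropy_self]; exact hη0)
        exact ⟨r, fun _ => ⟨hr, hr0, hri hi, by simpa [hk]⟩⟩
    choose r hr using hex
    have h1 := h.le_sum_erase hj (r := r) (fun k hk => (hr k hk).1) (fun k hk => (hr k hk).2.1)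
      (fun q hq hq1 hqr => withRow_noIndifferences hP fun k hk => by
        rw [hqr k hk]; exact (hr k hk).2.2.1)
    have h2 : ∀ k ∈ Finset.univ.erase j, relEntropy (P.prob j k) (r k) * N k ≤
        (if k ∈ P.superior j then N k * (P.divNoIndiff j k).toReal else 0) + η * N k := by
      intro k hk
      have h3 := mul_le_mul_of_nonneg_right (hr k (Finset.ne_of_mem_erase hk)).2.2.2 (hN k)
      have h4 := mul_nonneg hη0.le (hN k)
      split_ifs at h3 ⊢ <;> linarith
    have h5 : ∑ k ∈ Finset.univ.erase j,
        (if k ∈ P.superior j then N k * (P.divNoIndiff j k).toReal else 0) = X := by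
      rw [← Finset.sum_filter, Finset.filter_mem_eq_inter, Finset.inter_eq_right.2]
      exact fun k hk => Finset.mem_erase.2 ⟨(P.mem_superior.1 hk).1, Finset.mem_univ k⟩
    have h6 : ∑ k ∈ Finset.univ.erase j, η * N k ≤ ε := by
      rw [← Finset.mul_sum]
      have h7 : ∑ k ∈ Finset.univ.erase j, N k ≤ ∑ k, N k :=
        Finset.sum_le_sum_of_subset_of_nonneg (Finset.erase_subset _ _) fun k _ _ => hN k
      calc η * ∑ k ∈ Finset.univ.erase j, N k ≤ η * (1 + ∑ k, N k) :=
            mul_le_mul_of_nonneg_left (by linarith) hη0.le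
        _ = ε := div_mul_cancel₀ _ (by positivity)
    have h8 := h1.trans (Finset.sum_le_sum h2)
    rw [Finset.sum_add_distrib, h5] at h8
    linarith
  rw [coeffNoIndiff, mul_max_of_nonneg _ _ hc]
  refine max_le hfirst ?_
  -- The gap is a positive integer, so the denominator is at least the numerator; for gap at least 2
  -- it is also positive.
  have hcoef : (if w ∈ P.superior j then
      (if P.gap j = 1 then 1 else
        (((P.superior j).card : ℝ) - 1) / (((P.superior j).card : ℝ) + P.gap j - 2))
      else 0) ≤ 1 := by
    split_ifs with hwL hg
    · exact le_rfl
    · have hgap := gap_pos hw hj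
      have h1 : (1 : ℝ) ≤ (P.superior j).card := by
        exact_mod_cast Finset.card_pos.2 ⟨w, hwL⟩
      have h2 : 1 ≤ P.gap j := by
        rw [hd] at hgap ⊢
        exact_mod_cast hgap
      exact div_le_one_of_le₀ (by linarith) (by linarith)
    · exact zero_le_one
  exact (mul_le_of_le_one_right hc hcoef).trans hall

theorem divIndiff_ne_top {j k : Fin n}
    (hpos : 0 < P.pSucc j k ∧ 0 < P.pIndiff j k ∧ 0 < P.pPrec j k) : P.divIndiff j k ≠ ⊤ := by
  obtain ⟨h1, h2, h3⟩ := hpos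
  refine (max_lt ?_ ?_).ne <;>
  · rw [categoricalKL, if_pos]
    · exact ENNReal.ofReal_lt_top
    · intro i hi
      fin_cases i <;> simp at hi <;> linarith

theorem relEntropy_le_divIndiff {j k : Fin n}
    (hpos : 0 < P.pSucc j k ∧ 0 < P.pIndiff j k ∧ 0 < P.pPrec j k) :
    relEntropy (P.prob j k) (P.prob k j) ≤ (P.divIndiff j k).toReal ∧
      (P.prob j k .indiff - P.prob j k .succ) *
        (Real.log (P.prob j k .indiff) - Real.log (P.prob j k .succ)) ≤
          (P.divIndiff j k).toReal := by
  have htop := divIndiff_ne_top hpos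
  obtain ⟨h1, h2, h3⟩ := hpos
  constructor
  · have hle := le_max_right
      (categoricalKL ![P.pSucc j k, P.pIndiff j k, P.pPrec j k]
        ![P.pIndiff j k, P.pSucc j k, P.pPrec j k])
      (categoricalKL ![P.pSucc j k, P.pIndiff j k, P.pPrec j k]
        ![P.pPrec j k, P.pIndiff j k, P.pSucc j k])
    refine le_trans (le_of_eq ?_) ((le_toReal_categoricalKL (ne_top_of_le_ne_top htop hle)).trans
      (ENNReal.toReal_mono htop hle))
    rw [P.prob_swap j k]
    simp [relEntropy, Feedback.sum_eq, prob, swap, Fin.sum_univ_three]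
  · have hle := le_max_left
      (categoricalKL ![P.pSucc j k, P.pIndiff j k, P.pPrec j k]
        ![P.pIndiff j k, P.pSucc j k, P.pPrec j k])
      (categoricalKL ![P.pSucc j k, P.pIndiff j k, P.pPrec j k]
        ![P.pPrec j k, P.pIndiff j k, P.pSucc j k])
    refine le_trans (le_of_eq ?_) ((le_toReal_categoricalKL (ne_top_of_le_ne_top htop hle)).trans
      (ENNReal.toReal_mono htop hle))
    simp [prob, Fin.sum_univ_three, Real.log_div h1.ne' h2.ne', Real.log_div h2.ne' h1.ne',
      div_self h3.ne']
    ring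

/-- The factor `value (P.prob k j)` is 1 on superior and 1/2 on indifferent arms. It matches the
full cost of a swap and the halved cost from `exists_isWinningLaw_of_indiff`. -/
theorem coeffIndiff_mul_le {w j : Fin n} {c : ℝ} {N : Fin n → ℝ}
    (hN : ∀ k, 0 ≤ N k) (h : P.RowBound Set.univ w j c N) (hw : P.copelandSet = {w}) (hj : j ≠ w)
    (hpos : ∀ j k, j ≠ k → 0 < P.pSucc j k ∧ 0 < P.pIndiff j k ∧ 0 < P.pPrec j k) :
    c * P.coeffIndiff j ≤ ∑ k ∈ P.superior j ∪ P.indifferent j,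
      value (P.prob k j) * N k * (P.divIndiff j k).toReal := by
  classical
  set z : Fin n → ℝ := fun k => value (P.prob k j) * N k * (P.divIndiff j k).toReal with hz
  have hz0 : ∀ k, 0 ≤ z k := fun k =>
    mul_nonneg (mul_nonneg (value_nonneg _) (hN k)) ENNReal.toReal_nonneg
  have hsum0 : ∀ U : Finset (Fin n), 0 ≤ ∑ k ∈ U, z k := fun U =>
    Finset.sum_nonneg fun k _ => hz0 k
  rcases (P.psi j).eq_empty_or_nonempty with he | hne
  · simpa [coeffIndiff, he] using hsum0 _
  have hprob : ∀ k ≠ j, ∀ x, 0 < P.prob j k x := by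
    intro k hk x
    obtain ⟨h1, h2, h3⟩ := hpos j k hk.symm
    cases x <;> assumption
  have hex : ∀ k, ∃ r, k ∈ P.superior j ∪ P.indifferent j → IsWinningLaw r ∧
      (∀ x, r x = 0 → P.prob j k x = 0) ∧ relEntropy (P.prob j k) r * N k ≤ z k := by
    intro k
    by_cases hL : k ∈ P.superior j
    · have hkj := (P.mem_superior.1 hL).1
      refine ⟨P.prob k j, fun _ => ⟨isWinningLaw_of_mem_superior hL, fun x hx => ?_, ?_⟩⟩
      · rw [P.prob_swap j k] at hx
        exact absurd hx (hprob k hkj (swap x)).ne'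
      · simp only [hz]
        rw [(value_of_mem_superior hL).2, one_mul, mul_comm]
        exact mul_le_mul_of_nonneg_left (relEntropy_le_divIndiff (hpos j k hkj.symm)).1 (hN k)
    by_cases hI : k ∈ P.indifferent j
    · obtain ⟨hkj, h1, h2⟩ := P.mem_indifferent.1 hI
      obtain ⟨r, hr, hr0, hrB⟩ :=
        exists_isWinningLaw_of_indiff (hprob k hkj) (P.sum_prob j k) h1 h2
      refine ⟨r, fun _ => ⟨hr, hr0, ?_⟩⟩
      have h3 := (relEntropy_le_divIndiff (hpos j k hkj.symm)).2
      have h4 := mul_le_mul_of_nonneg_right (hrB.trans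
        (mul_le_mul_of_nonneg_left h3 (by norm_num : (0 : ℝ) ≤ 1 / 2))) (hN k)
      simp only [hz]
      rw [(value_of_mem_indifferent hI).2]
      linarith
    · exact ⟨P.prob j k, fun hk => by simp [hL, hI] at hk⟩
  choose r hr using hex
  obtain ⟨x, hx, hxeq⟩ := Finset.exists_mem_eq_sup (P.psi j) hne fun x =>
    (((P.indifferent j).card.choose x.1 : ℝ≥0) * ((P.superior j).card.choose x.2 : ℝ≥0)) /
      ((if 1 ≤ x.1 then
          (((P.indifferent j).card - 1).choose (x.1 - 1) : ℝ≥0) *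
            ((P.superior j).card.choose x.2 : ℝ≥0) else 0) +
        (if 1 ≤ x.2 then
          ((P.indifferent j).card.choose x.1 : ℝ≥0) *
            (((P.superior j).card - 1).choose (x.2 - 1) : ℝ≥0) else 0))
  -- Read as gap < i / 2 + l, the score that `j` gains from the chosen arms.
  have hxgap : 2 * P.gap j + 1 ≤ (x.1 : ℝ) + 2 * (x.2 : ℝ) := (Finset.mem_filter.1 hx).2
  have havg := choose_mul_choose_mul_le (P.indifferent j) (P.superior j) x.1 x.2 z c (by
    intro S hS T hT
    obtain ⟨hSI, hSc⟩ := Finset.mem_powersetCard.1 hS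
    obtain ⟨hTL, hTc⟩ := Finset.mem_powersetCard.1 hT
    have hdisj : Disjoint S T := Finset.disjoint_of_subset_left hSI
      (Finset.disjoint_of_subset_right hTL (P.disjoint_indifferent_superior j))
    have hsub : ∀ k ∈ S ∪ T, k ∈ P.superior j ∪ P.indifferent j := fun k hk =>
      (Finset.mem_union.1 hk).elim (fun h' => Finset.mem_union_right _ (hSI h'))
        (fun h' => Finset.mem_union_left _ (hTL h'))
    rw [← Finset.sum_union hdisj]
    refine (h.le_sum hw hj (S ∪ T) ?_ (fun k hk => (hr k (hsub k hk)).1)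
      (fun k hk => (hr k (hsub k hk)).2.1) ?_ (fun _ _ _ _ => Set.mem_univ _)).trans
      (Finset.sum_le_sum fun k hk => (hr k (hsub k hk)).2.2)
    · intro hjU
      rcases Finset.mem_union.1 (hsub j hjU) with h' | h'
      · exact (P.mem_superior.1 h').1 rfl
      · exact (P.mem_indifferent.1 h').1 rfl
    · rw [Finset.sum_union hdisj,
        Finset.sum_congr rfl fun k hk => by rw [(value_of_mem_indifferent (hSI hk)).1],
        Finset.sum_congr (s₁ := T) rfl fun k hk => by rw [(value_of_mem_superior (hTL hk)).1],
        Finset.sum_const, Finset.sum_const, hSc, hTc, nsmul_eq_mul, nsmul_eq_mul]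
      linarith)
  rw [coeffIndiff, hxeq, Finset.sum_union (P.disjoint_indifferent_superior j).symm]
  have hite : ∀ (p : Prop) [Decidable p] (a : ℝ≥0),
      ((if p then a else 0 : ℝ≥0) : ℝ) = if p then (a : ℝ) else 0 := by
    intro p _ a
    split_ifs <;> rfl
  rw [NNReal.coe_div, NNReal.coe_add, hite, hite]
  push_cast
  set u : ℝ := if 1 ≤ x.1 then (((P.indifferent j).card - 1).choose (x.1 - 1) : ℝ) *
    ((P.superior j).card.choose x.2 : ℝ) else 0 with hu
  set v : ℝ := if 1 ≤ x.2 then ((P.indifferent j).card.choose x.1 : ℝ) *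
    (((P.superior j).card - 1).choose (x.2 - 1) : ℝ) else 0 with hv
  have hu0 : 0 ≤ u := by rw [hu]; positivity
  have hv0 : 0 ≤ v := by rw [hv]; positivity
  have hI0 := hsum0 (P.indifferent j)
  have hL0 := hsum0 (P.superior j)
  rw [mul_div_assoc', mul_comm c]
  refine div_le_of_le_mul₀ (by positivity) (by positivity) (havg.trans ?_)
  nlinarith [mul_nonneg hu0 hL0, mul_nonneg hv0 hI0]

end DuelingProblem

/-! ### Summation over the arms and the theorem -/

namespace DuelingAlgorithm

open DuelingProblem Feedback

variable {n : ℕ} (A : DuelingAlgorithm.{u} n)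

theorem rowBound {S : Set (DuelingProblem n)} {δ : ℝ} (hδ0 : 0 < δ) (hδ : δ < 1 / 2)
    (hA : A.IdentifiesCopelandWinner S δ) {P : DuelingProblem n} (hPS : P ∈ S) {w j : Fin n}
    (hw : P.copelandSet = {w}) (hfin : A.expectedSamples P ≠ ⊤) :
    P.RowBound S w j (Real.log (1 / (2.4 * δ)))
      fun k => (A.expectedDuels P (j, k)).toReal + (A.expectedDuels P (k, j)).toReal := by
  intro q hq hq1 hac hQS hwQ
  refine (log_one_div_le hδ0 hδ).trans ((A.le_sum_relEntropy_mul_expectedDuels hδ0 hδ hfin ?_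
    (hA P hPS) (hA _ hQS) hw hwQ).trans (le_of_eq ?_))
  · intro a b x hx
    by_cases ha : a = j <;> by_cases hb : b = j
    · subst ha hb
      rwa [withRow_prob_diag] at hx
    · subst ha
      rw [withRow_prob_self hb] at hx
      exact hac b hb x hx
    · subst hb
      rw [withRow_prob_right ha] at hx
      rw [P.prob_swap b a]
      exact hac a ha _ hx
    · rwa [withRow_prob_of_ne ha hb] at hx
  · exact withRow_sum_relEntropy fun d => (A.expectedDuels P d).toReal

/-- After relabelling, each ordered pair is counted with weight `value (P.prob k j) + value (P.prob
j k)`, which is at most 1. -/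
theorem sum_ofReal_value_mul_le {P : DuelingProblem n} (hfin : A.expectedSamples P ≠ ⊤)
    (J : Finset (Fin n)) (U : Fin n → Finset (Fin n)) :
    ∑ j ∈ J, ENNReal.ofReal (∑ k ∈ U j, value (P.prob k j) *
      ((A.expectedDuels P (j, k)).toReal + (A.expectedDuels P (k, j)).toReal)) ≤
        A.expectedSamples P := by
  set e : Fin n → Fin n → ℝ := fun j k => (A.expectedDuels P (j, k)).toReal with he
  have he0 : ∀ j k, 0 ≤ e j k := fun j k => ENNReal.toReal_nonneg
  have hdfin : ∀ d, A.expectedDuels P d ≠ ⊤ := fun d =>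
    ne_top_of_le_ne_top hfin ((Finset.single_le_sum (fun _ _ => zero_le)
      (Finset.mem_univ d)).trans (A.sum_expectedDuels_le P))
  have hterm : ∀ j k, 0 ≤ value (P.prob k j) * (e j k + e k j) := fun j k =>
    mul_nonneg (value_nonneg _) (add_nonneg (he0 j k) (he0 k j))
  calc _ ≤ ∑ j, ENNReal.ofReal (∑ k, value (P.prob k j) * (e j k + e k j)) := by
        refine (Finset.sum_le_sum_of_subset (Finset.subset_univ J)).trans
          (Finset.sum_le_sum fun j _ => ENNReal.ofReal_le_ofReal ?_)
        exact Finset.sum_le_sum_of_subset_of_nonneg (Finset.subset_univ _)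
          fun k _ _ => hterm j k
    _ = ENNReal.ofReal (∑ j, ∑ k, value (P.prob k j) * (e j k + e k j)) :=
        (ENNReal.ofReal_sum_of_nonneg fun j _ => Finset.sum_nonneg fun k _ => hterm j k).symm
    _ ≤ ENNReal.ofReal (∑ j, ∑ k, e j k) := by
        refine ENNReal.ofReal_le_ofReal ?_
        have h1 : ∑ j, ∑ k, value (P.prob k j) * (e j k + e k j) =
            ∑ j, ∑ k, (value (P.prob k j) + value (P.prob j k)) * e j k := by
          simp only [mul_add, add_mul, Finset.sum_add_distrib]
          congr 1
          rw [Finset.sum_comm]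
        rw [h1]
        refine Finset.sum_le_sum fun j _ => Finset.sum_le_sum fun k _ =>
          mul_le_of_le_one_left (he0 j k) ?_
        rw [P.prob_swap k j]
        exact value_add_value_swap_le _
    _ = ∑ d, A.expectedDuels P d := by
        rw [← Fintype.sum_prod_type' e, ENNReal.ofReal_sum_of_nonneg fun d _ => he0 d.1 d.2]
        exact Finset.sum_congr rfl fun d _ => ENNReal.ofReal_toReal (hdfin d)
    _ ≤ A.expectedSamples P := A.sum_expectedDuels_le P

/-- The sample complexity bound follows from bounds for the single arms. -/
theorem mul_sum_le_expectedSamples {P : DuelingProblem n} (hfin : A.expectedSamples P ≠ ⊤)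
    {w : Fin n} {c : ℝ} (hc : 0 ≤ c) {C : Fin n → ℝ} {D : Fin n → Fin n → ℝ≥0∞}
    (h : ∀ j ≠ w, (∀ k ∈ P.superior j ∪ P.indifferent j, D j k ≠ ⊤) →
      c * C j ≤ ∑ k ∈ P.superior j ∪ P.indifferent j, value (P.prob k j) *
        ((A.expectedDuels P (j, k)).toReal + (A.expectedDuels P (k, j)).toReal) *
          (D j k).toReal) :
    ENNReal.ofReal c * ∑ j ∈ Finset.univ.erase w, ENNReal.ofReal (C j) *
      (⨅ k ∈ P.superior j ∪ P.indifferent j, (D j k)⁻¹) ≤ A.expectedSamples P := by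
  refine le_trans ?_ (A.sum_ofReal_value_mul_le hfin (Finset.univ.erase w)
    fun j => P.superior j ∪ P.indifferent j)
  rw [Finset.mul_sum]
  refine Finset.sum_le_sum fun j hj => ?_
  rw [← mul_assoc, ← ENNReal.ofReal_mul hc]
  exact ofReal_mul_iInf_inv_le _ (D j) _
    (fun k _ => mul_nonneg (value_nonneg _) (by positivity)) (h j (Finset.ne_of_mem_erase hj))

end DuelingAlgorithm

theorem theorem2p1 (n : ℕ) (hn : 2 ≤ n) (δ : ℝ) (hδ0 : 0 < δ) (hδ1 : δ < 1)
    (A : DuelingAlgorithm.{u} n) :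
    (A.IdentifiesCopelandWinner {Q | Q.NoIndifferences} δ →
      ∀ (P : DuelingProblem n) (w : Fin n), P.NoIndifferences → P.copelandSet = {w} →
        ENNReal.ofReal (Real.log (1 / (2.4 * δ))) *
            ∑ j ∈ Finset.univ.erase w,
              ENNReal.ofReal (P.coeffNoIndiff w j) *
                (⨅ k ∈ P.superior j ∪ P.indifferent j, (P.divNoIndiff j k)⁻¹)
          ≤ A.expectedSamples P) ∧
    (A.IdentifiesCopelandWinner Set.univ δ →
      ∀ (P : DuelingProblem n) (w : Fin n),
        (∀ j k, j ≠ k → 0 < P.pSucc j k ∧ 0 < P.pIndiff j k ∧ 0 < P.pPrec j k) →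
        P.copelandSet = {w} →
        ENNReal.ofReal (Real.log (1 / (2.4 * δ))) *
            ∑ j ∈ Finset.univ.erase w,
              (P.coeffIndiff j : ℝ≥0∞) *
                (⨅ k ∈ P.superior j ∪ P.indifferent j, (P.divIndiff j k)⁻¹)
          ≤ A.expectedSamples P) := by
  -- Here 2.4 δ ≥ 1.2, so the logarithm is negative and the left-hand sides are 0.
  by_cases hδ : 1 / 2 ≤ δ
  · have hlog : Real.log (1 / (2.4 * δ)) ≤ 0 := by
      refine Real.log_nonpos (by positivity) ?_
      rw [div_le_one (by positivity)]
      linarith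
    simp only [ENNReal.ofReal_of_nonpos hlog, zero_mul, zero_le, implies_true, and_self]
  push Not at hδ
  by_cases hlog : Real.log (1 / (2.4 * δ)) ≤ 0
  · simp only [ENNReal.ofReal_of_nonpos hlog, zero_mul, zero_le, implies_true, and_self]
  push Not at hlog
  constructor
  · intro hA P w hP hw
    by_cases hfin : A.expectedSamples P = ⊤
    · rw [hfin]
      exact le_top
    refine A.mul_sum_le_expectedSamples hfin hlog.le fun j hj hD => ?_
    rw [hP.indifferent_eq_empty, Finset.union_empty] at hD ⊢
    refine (hP.coeffNoIndiff_mul_le hlog.le (fun k => by positivity)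
      (A.rowBound hδ0 hδ hA hP hw hfin) hw hj hD).trans (le_of_eq ?_)
    refine Finset.sum_congr rfl fun k hk => ?_
    rw [(DuelingProblem.value_of_mem_superior hk).2, one_mul]
  · intro hA P w hpos hw
    by_cases hfin : A.expectedSamples P = ⊤
    · rw [hfin]
      exact le_top
    have h := A.mul_sum_le_expectedSamples hfin hlog.le (w := w) (C := fun j => P.coeffIndiff j)
      (D := P.divIndiff) fun j hj _ => DuelingProblem.coeffIndiff_mul_le
        (fun k => by positivity) (A.rowBound hδ0 hδ hA (Set.mem_univ P) hw hfin) hw hj hpos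
    simpa only [ENNReal.ofReal_coe_nnreal] using h
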